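/- **Networks.** A network $N$ with $k$ edge types is a finite set $C$ of cells with functions $\sigma_1,\dots,\sigma_k:C\to C$ ($\sigma_i(c)$ is the source of the unique edge of type $i$ with target $c$); networks are identified up to bijections of the cells that commute with the $\sigma_i$. A coloring (equivalence relation) $\bowtie$ on $C$ is balanced if $c\bowtie c'$ implies $\sigma_i(c)\bowtie\sigma_i(c')$ for all $i$; the quotient $N/{\bowtie}$ is then the network of $\bowtie$-classes with $[c]\mapsto[\sigma_i(c)]$, and $L$ is a lift of $N$ if $N=L/{\bowtie}$ for some balanced coloring $\bowtie$ of $L$. A feed-forward network with layers $C_0,\dots,C_m$ is a network, connected as an undirected graph, whose cells are partitioned into nonempty sets $C_0,\dots,C_m$ such that $\sigma_i(c)=c$ for $c\in C_0$, $\sigma_i(C_j)\subseteq C_{j-1}$ for $1\le j\le m$, and every cell of $C_j$ with $j<m$ is $\sigma_i(c')$ for some $i$ and some $c'\in C_{j+1}$. Let $N$ and $L$ be feed-forward networks with layers $C_0,\dots,C_m$ and $C'_0,\dots,C'_n$, with $L$ a lift of $N$. Then $L$ is a lift *inside the first layer* if $m=n$, $|C'_0|\ne|C_0|$ and $|C'_i|=|C_i|$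 for $1\le i\le m$. It is a lift *that creates new layers* if $m<n$, $|C'_0|=\dots=|C'_{n-m}|=|C_0|$ and $|C'_{n-m+j}|=|C_j|$ for $1\le j\le m$. **Systems.** Let $\mathcal V$ be the space of smooth $f:\mathbb R\times\mathbb R^k\times\mathbb R\to\mathbb R$ with $f(0,0,\lambda)=0$ for all $\lambda$, with the $C^\infty$ topology (uniform convergence of all derivatives on compact sets), and let $\mathcal V_0=\{f\in\mathcal V:\partial f/\partial x_0(0)=0\}$ with the induced topology. Put $(f^N(x,\lambda))_c=f(x_c,x_{\sigma_1(c)},\dots,x_{\sigma_k(c)},\lambda)$ for $x\in\mathbb R^{C}$. **Branches.** Let $D$ be $[0,\lambda_0[$, $]-\lambda_0,0]$ (one-sided) or $]-\lambda_0,\lambda_0[$, with $\lambda_0>0$. A bifurcation branch of $f$ on $N$ is a continuous $b:D\to\mathbb R^{C}$, smooth on $D\setminus\{0\}$, with $b(0)=0$, $f^N(b(\lambda),\lambda)=0$ for all $\lambda\in D$, and $b$ not identically $0$ on any neighbourhood of $0$ in $D$. A bifurcation branch $b$ of $f$ on $L$ is *lifted from $N$* if there is a balanced coloring $\bowtie$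 of $L$ with $L/{\bowtie}=N$ such that, for all $\lambda\in D$ close to $0$, $b_c(\lambda)=b_d(\lambda)$ whenever $c\bowtie d$. For one-sided $D$, a component $b_c$ whose germ at $0$ is not zero has square-root-order $p\ge0$ if $p$ is the smallest non-negative integer for which there is a smooth $b_c^*:[0,\varepsilon[\to\mathbb R$ with $b_c(\lambda)=b_c^*(|\lambda|^{2^{-p}})$ for $\lambda\in D$ near $0$ and such that $\lim_{\lambda\to0,\,\lambda\in D\setminus\{0\}}b_c^*(|\lambda|)/\lambda$ exists and is nonzero. A component with zero germ has square-root-order $-1$. The square-root-order of $b$ is the maximum of those of its components, when these all exist. **Proposition.** For every $k$ there is an open and dense set $\mathcal G\subseteq\mathcal V_0$ such that the following holds for every $f\in\mathcal G$, every feed-forward network $N$ with $k$ edge types and every feed-forward lift $L$ of $N$. (i) If $L$ is a lift inside the first layer, then every bifurcation branch of $f$ on $L$ is lifted from $N$. (ii) If $L$ is a lift that creates new layers, then there is a bifurcation branch of $f$ on $L$ which is not lifted from $N$. Moreover, it can be chosen on a one-sided domain and with a square-root-order which is larger than the square-root-order of every bifurcation branch of $f$ on $N$ that is defined on a one-sided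 domain and has a square-root-order. -/

import Mathlib

open Set Filter Topology
open scoped ContDiff

noncomputable section

/-! ### Networks, balanced colorings, quotients and lifts -/

/-- A network with `k` edge types on the set of cells `C`, in which every cell is the target of
exactly one edge of each type: `input i c` is the source of the edge of type `i` with target `c`. -/
structure CellNetwork (k : ℕ) (C : Type*) where
  input : Fin k → C → C

namespace CellNetwork

variable {k : ℕ} {C C' : Type*}

/-- Equality of networks up to a bijection of the cells that respects every edge type. -/
def SameAs (N : CellNetwork k C) (N' : CellNetwork k C') : Prop :=
  ∃ φ : C ≃ C', ∀ i c, φ (N.input i c) = N'.input i (φ c)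

/-- A coloring (an equivalence relation on the cells) is balanced if the sources of the edges of
equal type into cells of equal color have equal color. -/
def IsBalanced (N : CellNetwork k C) (r : Setoid C) : Prop :=
  ∀ i c c', r c c' → r (N.input i c) (N.input i c')

/-- The quotient network of a balanced coloring. -/
def quotient (N : CellNetwork k C) (r : Setoid C) (h : N.IsBalanced r) :
    CellNetwork k (Quotient r) where
  input i := Quotient.map (N.input i) fun c c' hc => h i c c' hc

/-- `r` is a balanced coloring of `L` and the quotient of `L` by `r` is `N`. -/
def IsQuotientBy (L : CellNetwork k C') (r : Setoid C') (N : CellNetwork k C) : Prop :=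
  ∃ h : L.IsBalanced r, (L.quotient r h).SameAs N

/-- `L` is a lift of `N`. -/
def IsLift (L : CellNetwork k C') (N : CellNetwork k C) : Prop :=
  ∃ r : Setoid C', L.IsQuotientBy r N

/-- The underlying undirected graph of the network is connected. -/
def IsConnected (N : CellNetwork k C) : Prop :=
  ∀ c c', Relation.ReflTransGen
    (fun a b => (∃ i, a = N.input i b) ∨ (∃ i, b = N.input i a)) c c'

/-! ### Feed-forward networks -/

/-- `N` is a feed-forward network whose layers are `C_j = {c | layer c = j}`, `0 ≤ j ≤ m`. -/
structure IsFeedForward (N : CellNetwork k C) (m : ℕ) (layer : C → ℕ) : Prop where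
  layer_le : ∀ c, layer c ≤ m
  layer_nonempty : ∀ j ≤ m, ∃ c, layer c = j
  input_first : ∀ c, layer c = 0 → ∀ i, N.input i c = c
  input_next : ∀ c, layer c ≠ 0 → ∀ i, layer (N.input i c) + 1 = layer c
  isSource : ∀ c, layer c < m → ∃ c' i, layer c' = layer c + 1 ∧ c = N.input i c'
  connected : N.IsConnected

end CellNetwork

/-- Numerical conditions on the layers for a feed-forward lift (layers `0, …, n`, layer function
`layer'`) of a feed-forward network (layers `0, …, m`, layer function `layer`) to be a lift inside
the layer `C_j`. -/
def IsInsideLayer {C C' : Type*} (m : ℕ) (layer : C → ℕ) (n : ℕ) (layer' : C' → ℕ)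
    (j : ℕ) : Prop :=
  j ≤ m ∧ m = n ∧ {c | layer' c = j}.ncard ≠ {c | layer c = j}.ncard ∧
    ∀ i ≤ m, i ≠ j → {c | layer' c = i}.ncard = {c | layer c = i}.ncard

/-- Numerical conditions on the layers for a feed-forward lift to be a lift that creates
`n - m` new layers. -/
def CreatesNewLayers {C C' : Type*} (m : ℕ) (layer : C → ℕ) (n : ℕ) (layer' : C' → ℕ) : Prop :=
  m < n ∧ (∀ i ≤ n - m, {c | layer' c = i}.ncard = {c | layer c = 0}.ncard) ∧
    ∀ j, 1 ≤ j → j ≤ m → {c | layer' c = n - m + j}.ncard = {c | layer c = j}.ncard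

/-! ### The families of coupled cell systems -/

/-- The space `𝒱` of smooth families `f : ℝ × ℝᵏ × ℝ → ℝ`, `(x₀, (x₁, …, x_k), t) ↦ f(x, t)`,
with `f (0, 0, t) = 0` for every value `t` of the parameter. -/
structure SmoothFamily (k : ℕ) where
  toFun : ℝ × (Fin k → ℝ) × ℝ → ℝ
  smooth : ContDiff ℝ ∞ toFun
  zero_eq : ∀ t : ℝ, toFun (0, 0, t) = 0

namespace SmoothFamily

variable {k : ℕ}

/-- The `j`-th derivative of `f`, as a continuous map. -/
def jetMap (j : ℕ) (f : SmoothFamily k) :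
    C(ℝ × (Fin k → ℝ) × ℝ, (ℝ × (Fin k → ℝ) × ℝ) [×j]→L[ℝ] ℝ) where
  toFun := iteratedFDeriv ℝ j f.toFun
  continuous_toFun := f.smooth.continuous_iteratedFDeriv (by exact_mod_cast le_top)

/-- The `C^∞` topology: uniform convergence on compact sets of the derivatives of every order. -/
instance : TopologicalSpace (SmoothFamily k) :=
  ⨅ j : ℕ, TopologicalSpace.induced (jetMap j) inferInstance

/-- The set `𝒱₀` of families with a bifurcation condition associated with the internal dynamics:
`f₀ = ∂f/∂x₀ (0) = 0`. -/
def internalDynamics (k : ℕ) : Set (SmoothFamily k) :=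
  {f | deriv (fun x : ℝ => f.toFun (x, 0, 0)) 0 = 0}

/-- The admissible vector field of the network `N` given by `f`, at the parameter `t`. -/
def vectorField {C : Type*} (f : SmoothFamily k) (N : CellNetwork k C) (x : C → ℝ) (t : ℝ) :
    C → ℝ :=
  fun c => f.toFun (x c, (fun i => x (N.input i c)), t)

end SmoothFamily

/-! ### Branches -/

/-- The domains of branches `[0, t₀)` and `(-t₀, 0]`. -/
def IsOneSidedDomain (D : Set ℝ) : Prop :=
  ∃ t₀ > 0, D = Ico 0 t₀ ∨ D = Ioc (-t₀) 0

/-- The domains of branches: `[0, t₀)`, `(-t₀, 0]` and `(-t₀, t₀)`. -/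
def IsBranchDomain (D : Set ℝ) : Prop :=
  IsOneSidedDomain D ∨ ∃ t₀ > 0, D = Ioo (-t₀) t₀

/-- An equilibrium branch of `f` on `N` that emanates from the fully synchronous equilibrium `0`
at `t = 0`: it is continuous, it is smooth away from `t = 0` (at `t = 0` a branch may behave like
`|t| ^ (2 ^ (-p))`), and it consists of equilibria. -/
structure IsEquilibriumBranch {k : ℕ} {C : Type*} [Fintype C] (f : SmoothFamily k)
    (N : CellNetwork k C) (D : Set ℝ) (b : ℝ → C → ℝ) : Prop where
  domain : IsBranchDomain D
  continuousOn : ContinuousOn b D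
  smooth : ContDiffOn ℝ ∞ b (D \ {0})
  zero_eq : b 0 = 0
  isEquilibrium : ∀ t ∈ D, f.vectorField N (b t) t = 0

/-- A bifurcation branch: an equilibrium branch whose germ at `0` is not that of the trivial
branch. -/
def IsBifurcationBranch {k : ℕ} {C : Type*} [Fintype C] (f : SmoothFamily k)
    (N : CellNetwork k C) (D : Set ℝ) (b : ℝ → C → ℝ) : Prop :=
  IsEquilibriumBranch f N D b ∧ ¬ ∀ᶠ t in 𝓝[D] 0, b t = 0

/-- The polydiagonal subspace of a coloring. -/
def polydiagonal {C : Type*} (r : Setoid C) : Set (C → ℝ) :=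
  {x | ∀ c d, r c d → x c = x d}

/-- The (germ of the) branch `b` on `L` is lifted from `N`. -/
def IsLiftedFrom {k : ℕ} {C C' : Type*} (L : CellNetwork k C') (N : CellNetwork k C)
    (D : Set ℝ) (b : ℝ → C' → ℝ) : Prop :=
  ∃ r : Setoid C', L.IsQuotientBy r N ∧ ∀ᶠ t in 𝓝[D] 0, b t ∈ polydiagonal r

/-! ### Square-root-orders -/

/-- Near `0`, the function `g` on the one-sided domain `D` is `t ↦ g' (|t| ^ (2 ^ (-p)))` for some
`g'` that is smooth on an interval `[0, ε)`, where `g' |t| / t` tends to `s ≠ 0` as `t → 0` in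
`D`. -/
def HasRootExpansion (D : Set ℝ) (g : ℝ → ℝ) (p : ℕ) (s : ℝ) : Prop :=
  s ≠ 0 ∧ ∃ ε > 0, ∃ g' : ℝ → ℝ, ContDiffOn ℝ ∞ g' (Ico 0 ε) ∧
    (∀ t ∈ D, |t| ^ ((2 : ℝ)⁻¹ ^ p) < ε → g t = g' (|t| ^ ((2 : ℝ)⁻¹ ^ p))) ∧
    Tendsto (fun t => g' |t| / t) (𝓝[D \ {0}] 0) (𝓝 s)

/-- The germ at `0` of `g` on the one-sided domain `D` has square-root-order `p`; the zero germ has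
square-root-order `-1`. -/
def HasSquareRootOrder (D : Set ℝ) (g : ℝ → ℝ) (p : ℤ) : Prop :=
  ((∀ᶠ t in 𝓝[D] 0, g t = 0) ∧ p = -1) ∨
    ((¬ ∀ᶠ t in 𝓝[D] 0, g t = 0) ∧
      ∃ q : ℕ, p = q ∧ IsLeast {q : ℕ | ∃ s, HasRootExpansion D g q s} q)

/-- The branch `b` has square-root-order `p` in the set of cells `A`: the maximum of the
square-root-orders of its coordinates `b_c`, `c ∈ A`. -/
def HasSquareRootOrderIn {C : Type*} (D : Set ℝ) (b : ℝ → C → ℝ) (A : Set C) (p : ℤ) : Prop :=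
  ∃ q : C → ℤ, (∀ c ∈ A, HasSquareRootOrder D (fun t => b t c) (q c)) ∧ IsGreatest (q '' A) p

end

/-! ### Smooth parametric integrals and division by a coordinate -/

section Hadamard

variable {E F : Type} [NormedAddCommGroup E] [NormedSpace ℝ E] [FiniteDimensional ℝ E]
  [NormedAddCommGroup F] [NormedSpace ℝ F]

/-! Generic means that three derivatives at the origin are nonzero, so that on synchronous inputs `f
(x, (y, …, y), t) = x² P + x t Q + y R` with `P`, `Q`, `R` nonzero at the origin
(`exists_normalForm`; the last one needs an edge type).

A cell of the first layer is its own input, and its equation is `x * (x P + t Q + R) = 0`. The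
bracket is near `R (0) ≠ 0`, so such a cell stays at `0` along every branch. In a lift inside the
first layer, counting cells shows that the projection preserves layers and is injective outside the
first one. Identified cells are thus equal or both at `0`, which is (i).

For (ii), an equilibrium satisfies `x² ≤ C (|t| |x| + ‖y‖)`, so each layer at worst halves the
exponent: layer `j + 1` is `O(|t| ^ 2⁻ʲ)` and every order on `N` is less than `m`
(`squareRootOrder_lt`). Conversely, on one side of `t = 0` there is a branch on `L`, synchronous on
each layer, whose layer `j + 1` has order exactly `j` (`exists_layerwise_branch`: rescaling and the
implicit function theorem). Its order `n - 1` is at least `m`. It is not lifted from `N`, because a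
projection onto fewer layers identifies a cell of layer `1` with its source in layer `0`, and only
the latter vanishes. -/

theorem hasFDerivAt_integral_of_contDiff {G : E × ℝ → F} (hG : ContDiff ℝ 1 G) (x₀ : E) :
    HasFDerivAt (fun x => ∫ s in (0 : ℝ)..1, G (x, s))
      (∫ s in (0 : ℝ)..1, (fderiv ℝ G (x₀, s)).comp (ContinuousLinearMap.inl ℝ E ℝ)) x₀ := by
  have hG' : Continuous fun p : E × ℝ =>
      (fderiv ℝ G p).comp (ContinuousLinearMap.inl ℝ E ℝ) :=
    (hG.continuous_fderiv one_ne_zero).clm_comp continuous_const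
  have hc : IsCompact (Metric.closedBall x₀ 1 ×ˢ Icc (0 : ℝ) 1) :=
    (isCompact_closedBall x₀ 1).prod isCompact_Icc
  obtain ⟨M, hM⟩ := hc.exists_bound_of_continuousOn hG'.continuousOn
  refine intervalIntegral.hasFDerivAt_integral_of_dominated_of_fderiv_le
    (bound := fun _ => M) (𝕜 := ℝ)
    (F' := fun x s => (fderiv ℝ G (x, s)).comp (ContinuousLinearMap.inl ℝ E ℝ))
    (Metric.closedBall_mem_nhds x₀ one_pos) ?_ ?_ ?_ ?_ ?_ ?_
  · exact Eventually.of_forall fun x =>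
      (hG.continuous.comp (by fun_prop : Continuous fun s : ℝ => (x, s))).aestronglyMeasurable
  · exact (hG.continuous.comp
      (by fun_prop : Continuous fun s : ℝ => (x₀, s))).intervalIntegrable _ _
  · exact (hG'.comp (by fun_prop : Continuous fun s : ℝ => (x₀, s))).aestronglyMeasurable
  · refine Eventually.of_forall fun s hs x hx => hM (x, s) ⟨hx, ?_⟩
    rw [uIoc_of_le zero_le_one] at hs
    exact ⟨hs.1.le, hs.2⟩
  · exact intervalIntegrable_const
  · refine Eventually.of_forall fun s _ x _ => ?_
    have h1 : HasFDerivAt (fun y : E => (y, s)) (ContinuousLinearMap.inl ℝ E ℝ) x :=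
      hasFDerivAt_prodMk_left x s
    exact ((hG.differentiable one_ne_zero) (x, s)).hasFDerivAt.comp x h1

/-- The derivative is again a parametric integral, with values in a space of continuous linear maps.
The target space must therefore vary in the induction. -/
theorem contDiff_nat_integral (n : ℕ) : ∀ {F : Type} [NormedAddCommGroup F] [NormedSpace ℝ F]
    [CompleteSpace F] {G : E × ℝ → F}, ContDiff ℝ ∞ G →
    ContDiff ℝ n (fun x => ∫ s in (0 : ℝ)..1, G (x, s)) := by
  induction n with
  | zero =>
    intro F _ _ _ G hG
    exact contDiff_zero.2
      (intervalIntegral.continuous_parametric_intervalIntegral_of_continuous'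
        (f := fun x s => G (x, s)) hG.continuous 0 1)
  | succ n ih =>
    intro F _ _ _ G hG
    have h1 : ContDiff ℝ 1 G := hG.of_le (by exact_mod_cast le_top)
    have h2 := hasFDerivAt_integral_of_contDiff h1
    push_cast
    refine contDiff_succ_iff_fderiv.2 ⟨fun x => (h2 x).differentiableAt, by simp, ?_⟩
    rw [show fderiv ℝ (fun x => ∫ s in (0 : ℝ)..1, G (x, s)) = _ from funext fun x => (h2 x).fderiv]
    refine ih (G := fun p => (fderiv ℝ G p).comp (ContinuousLinearMap.inl ℝ E ℝ)) ?_
    exact (hG.fderiv_right (m := ∞) le_rfl).clm_comp contDiff_const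

theorem contDiff_integral [CompleteSpace F] {G : E × ℝ → F} (hG : ContDiff ℝ ∞ G) :
    ContDiff ℝ ∞ (fun x => ∫ s in (0 : ℝ)..1, G (x, s)) :=
  contDiff_infty.2 fun n => contDiff_nat_integral n hG

/-- Hadamard's lemma: a smooth function that vanishes where its first coordinate does is divisible
by this coordinate. -/
theorem exists_contDiff_eq_mul {K : ℝ × E → ℝ} (hK : ContDiff ℝ ∞ K) (h0 : ∀ e, K (0, e) = 0) :
    ∃ K' : ℝ × E → ℝ, ContDiff ℝ ∞ K' ∧ ∀ x e, K (x, e) = x * K' (x, e) := by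
  -- The quotient comes from integrating the derivative of `s ↦ K (s x, e)` over `[0, 1]`.
  refine ⟨fun p => ∫ s in (0 : ℝ)..1, fderiv ℝ K (s * p.1, p.2) (1, 0),
    contDiff_integral (G := fun q : (ℝ × E) × ℝ => fderiv ℝ K (q.2 * q.1.1, q.1.2) (1, 0)) ?_,
    fun x e => ?_⟩
  · have : ContDiff ℝ ∞ (fderiv ℝ K) := hK.fderiv_right le_rfl
    have h2 : ContDiff ℝ ∞ fun q : (ℝ × E) × ℝ => (q.2 * q.1.1, q.1.2) := by fun_prop
    exact (this.comp h2).clm_apply contDiff_const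
  · have hd : ∀ s : ℝ, HasDerivAt (fun s : ℝ => K (s * x, e))
        (x * fderiv ℝ K (s * x, e) (1, 0)) s := by
      intro s
      have h1 : HasDerivAt (fun s : ℝ => (s * x, e)) (x, (0 : E)) s :=
        (by simpa using (hasDerivAt_id s).mul_const x : HasDerivAt (fun s : ℝ => s * x) x s).prodMk
          (hasDerivAt_const s e)
      have h2 := ((hK.differentiable (by simp)) (s * x, e)).hasFDerivAt.comp_hasDerivAt s h1
      have h3 : ((x, 0) : ℝ × E) = x • ((1, 0) : ℝ × E) := by simp
      rw [h3, map_smul, smul_eq_mul] at h2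
      exact h2
    have hcont : Continuous fun s : ℝ => x * fderiv ℝ K (s * x, e) (1, 0) := by
      have := (hK.continuous_fderiv (by simp)).comp
        (by fun_prop : Continuous fun s : ℝ => (s * x, e))
      exact continuous_const.mul (this.clm_apply continuous_const)
    have := intervalIntegral.integral_eq_sub_of_hasDerivAt (a := 0) (b := 1)
      (fun s _ => hd s) (hcont.intervalIntegrable _ _)
    simp only [one_mul, zero_mul, h0, sub_zero, intervalIntegral.integral_const_mul] at this
    exact this.symm

end Hadamard

/-! ### A smooth implicit function on the line -/

/-- A bump function cuts the germ off. Globally smooth representatives make later compositions free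
of domain conditions. -/
theorem ContDiffAt.exists_contDiff_eventuallyEq {u : ℝ → ℝ} {a : ℝ}
    (hu : ∀ᶠ x in 𝓝 a, ContDiffAt ℝ ∞ u x) :
    ∃ v : ℝ → ℝ, ContDiff ℝ ∞ v ∧ v =ᶠ[𝓝 a] u := by
  obtain ⟨r, hr, hu⟩ := Metric.eventually_nhds_iff_ball.1 hu
  let χ : ContDiffBump a := ⟨r / 3, r / 2, by positivity, by linarith⟩
  refine ⟨fun x => χ x * u x, contDiff_iff_contDiffAt.2 fun x => ?_, ?_⟩
  · by_cases hx : x ∈ Metric.ball a r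
    · exact χ.contDiffAt.mul (hu x hx)
    · have : (fun x => χ x * u x) =ᶠ[𝓝 x] fun _ => 0 := by
        have hx' : x ∈ (Metric.closedBall a (r / 2))ᶜ := fun h =>
          hx (Metric.closedBall_subset_ball (by linarith) h)
        filter_upwards [Metric.isClosed_closedBall.isOpen_compl.mem_nhds hx'] with y hy
        have : χ y = 0 := χ.zero_of_le_dist (by
          simp only [mem_compl_iff, Metric.mem_closedBall, not_le] at hy; exact hy.le)
        simp [this]
      exact contDiffAt_const.congr_of_eventuallyEq this
  · filter_upwards [χ.eventuallyEq_one] with x hx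
    simp [hx]

theorem exists_contDiff_implicit {F : ℝ × ℝ → ℝ} (hF : ContDiff ℝ ∞ F) {u₀ c : ℝ}
    (h0 : F (0, u₀) = 0) (hc : HasDerivAt (fun u => F (0, u)) c u₀) (hc0 : c ≠ 0) :
    ∃ h : ℝ → ℝ, ContDiff ℝ ∞ h ∧ h 0 = u₀ ∧ ∀ᶠ x in 𝓝 0, F (x, h x) = 0 := by
  have inv : ∀ v : ℝ × ℝ, fderiv ℝ F v (0, 1) ≠ 0 →
      (fderiv ℝ F v ∘L .inr ℝ ℝ ℝ).IsInvertible := by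
    intro v hv
    refine ⟨ContinuousLinearEquiv.smulLeft (Units.mk0 _ hv), ?_⟩
    ext
    simp [Units.smul_def]
  have hinf : (∞ : WithTop ℕ∞) ≠ 0 := by simp
  have hc1 : fderiv ℝ F (0, u₀) (0, 1) = c := by
    have h1 : HasDerivAt (fun u : ℝ => ((0 : ℝ), u)) ((0 : ℝ), (1 : ℝ)) u₀ :=
      (hasDerivAt_const u₀ (0 : ℝ)).prodMk (hasDerivAt_id u₀)
    exact (((hF.differentiable hinf) (0, u₀)).hasFDerivAt.comp_hasDerivAt u₀ h1).unique hc
  have hcd : ∀ v, ContDiffAt ℝ ∞ F v := fun v => hF.contDiffAt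
  have i0 := inv (0, u₀) (by rw [hc1]; exact hc0)
  set ψ := (hcd (0, u₀)).implicitFunction hinf i0 with hψ
  have hψ0 : ψ 0 = u₀ := ContDiffAt.implicitFunction_apply_self _ hinf i0
  have hψF : ∀ᶠ x in 𝓝 0, F (x, ψ x) = 0 := by
    simpa [h0] using ContDiffAt.eventually_apply_implicitFunction (hcd (0, u₀)) hinf i0
  have hψc : ContDiffAt ℝ ∞ ψ 0 := ContDiffAt.contDiffAt_implicitFunction (hcd (0, u₀)) hinf i0
  have hcont : ∀ᶠ x in 𝓝 0, ContinuousAt ψ x := by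
    have h1 : ContDiffAt ℝ 1 ψ 0 := hψc.of_le (by exact_mod_cast le_top)
    exact (h1.eventually (by simp)).mono fun x hx => hx.continuousAt
  have hinv : ∀ᶠ x in 𝓝 0, fderiv ℝ F (x, ψ x) (0, 1) ≠ 0 := by
    have h1 : ContinuousAt (fun x => fderiv ℝ F (x, ψ x) (0, 1)) 0 := by
      have h2 : ContinuousAt (fun x => (x, ψ x)) 0 := continuousAt_id.prodMk hψc.continuousAt
      have h3 : ContinuousAt (fun x => fderiv ℝ F (x, ψ x)) 0 :=
        ContinuousAt.comp (g := fderiv ℝ F) (hF.continuous_fderiv hinf).continuousAt h2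
      exact h3.clm_apply continuousAt_const
    exact h1.eventually_ne (by rw [hψ0, hc1]; exact hc0)
  -- `ContDiffAt ℝ ∞` at `0` gives no common neighbourhood for all orders of differentiability. The
  -- implicit function theorem is applied afresh at each nearby `(x, ψ x)`, and local uniqueness
  -- identifies its solution with `ψ`.
  have hsm : ∀ᶠ x in 𝓝 0, ContDiffAt ℝ ∞ ψ x := by
    filter_upwards [hcont, hinv, hψF.eventually_nhds] with x hx1 hx2 hx3
    have ix := inv (x, ψ x) hx2
    have h1 := ContDiffAt.eventually_apply_eq_iff_implicitFunction (hcd (x, ψ x)) hinf ix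
    have h2 : Tendsto (fun y => (y, ψ y)) (𝓝 x) (𝓝 (x, ψ x)) :=
      (continuousAt_id.prodMk hx1 : ContinuousAt (fun y => (y, ψ y)) x)
    refine (ContDiffAt.contDiffAt_implicitFunction (hcd (x, ψ x)) hinf ix).congr_of_eventuallyEq ?_
    filter_upwards [h2.eventually h1, hx3] with y hy1 hy2
    exact (hy1.1 (hy2.trans hx3.self_of_nhds.symm)).symm
  obtain ⟨v, hv, hvψ⟩ := ContDiffAt.exists_contDiff_eventuallyEq hsm
  refine ⟨v, hv, hvψ.self_of_nhds.trans hψ0, ?_⟩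
  filter_upwards [hvψ, hψF] with x h1 h2
  rw [h1, h2]

namespace SmoothFamily

variable {k : ℕ}

/-! ### The genericity conditions -/

/-- The genericity conditions: `∂²f/∂x₀² (0) ≠ 0`, `∂²f/∂t∂x₀ (0) ≠ 0`, and, if there are edges,
`∑ i, ∂f/∂xᵢ (0) ≠ 0`. -/
def IsNondegenerate (f : SmoothFamily k) : Prop :=
  iteratedFDeriv ℝ 2 f.toFun 0 ![(1, 0, 0), (1, 0, 0)] ≠ 0 ∧
    iteratedFDeriv ℝ 2 f.toFun 0 ![(0, 0, 1), (1, 0, 0)] ≠ 0 ∧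
    (0 < k → iteratedFDeriv ℝ 1 f.toFun 0 ![(0, 1, 0)] ≠ 0)

theorem continuous_jetMap (j : ℕ) : Continuous (jetMap (k := k) j) :=
  continuous_iInf_dom (i := j) continuous_induced_dom

theorem continuous_iteratedFDeriv_apply (j : ℕ) (p : ℝ × (Fin k → ℝ) × ℝ)
    (v : Fin j → ℝ × (Fin k → ℝ) × ℝ) :
    Continuous fun f : SmoothFamily k => iteratedFDeriv ℝ j f.toFun p v := by
  have h1 : Continuous fun f : SmoothFamily k => jetMap j f p :=
    (continuous_eval_const p).comp (continuous_jetMap j)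
  exact (continuous_eval_const v).comp h1

theorem isOpen_isNondegenerate : IsOpen {f : SmoothFamily k | f.IsNondegenerate} := by
  have h : ∀ (j : ℕ) (v : Fin j → ℝ × (Fin k → ℝ) × ℝ),
      IsOpen {f : SmoothFamily k | iteratedFDeriv ℝ j f.toFun 0 v ≠ 0} := fun j v =>
    isOpen_ne_fun (continuous_iteratedFDeriv_apply j 0 v) continuous_const
  have h3 : IsOpen {f : SmoothFamily k | 0 < k → iteratedFDeriv ℝ 1 f.toFun 0 ![(0, 1, 0)] ≠ 0} := by
    by_cases hk : 0 < k
    · simpa [hk] using h 1 ![(0, 1, 0)]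
    · simp [hk]
  exact (h _ _).inter ((h _ _).inter h3)

/-- The translate `f + s • g` of a family. -/
def addSMul (f g : SmoothFamily k) (s : ℝ) : SmoothFamily k where
  toFun := f.toFun + s • g.toFun
  smooth := f.smooth.add (g.smooth.const_smul s)
  zero_eq t := by simp [f.zero_eq, g.zero_eq]

theorem iteratedFDeriv_addSMul (f g : SmoothFamily k) (s : ℝ) (j : ℕ) (p : ℝ × (Fin k → ℝ) × ℝ) :
    iteratedFDeriv ℝ j (addSMul f g s).toFun p =
      iteratedFDeriv ℝ j f.toFun p + s • iteratedFDeriv ℝ j g.toFun p := by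
  have hf : ContDiffAt ℝ j f.toFun p := (f.smooth.of_le (by exact_mod_cast le_top)).contDiffAt
  have hg : ContDiffAt ℝ j g.toFun p := (g.smooth.of_le (by exact_mod_cast le_top)).contDiffAt
  have h : iteratedFDeriv ℝ j (s • g.toFun) p = s • iteratedFDeriv ℝ j g.toFun p :=
    iteratedFDeriv_const_smul_apply hg
  rw [← h]
  exact iteratedFDeriv_add_apply hf (hg.const_smul s)

theorem continuous_addSMul (f g : SmoothFamily k) : Continuous (addSMul f g) := by
  refine continuous_iInf_rng.2 fun j => continuous_induced_rng.2 ?_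
  have : jetMap j ∘ addSMul f g = fun s => jetMap j f + s • jetMap j g := by
    funext s
    ext1 p
    exact iteratedFDeriv_addSMul f g s j p
  rw [this]
  fun_prop

theorem addSMul_zero (f g : SmoothFamily k) : addSMul f g 0 = f := by
  cases f
  simp [addSMul]

/-- A family which satisfies the genericity conditions. -/
def model (k : ℕ) : SmoothFamily k where
  toFun p := p.1 ^ 2 + p.1 * p.2.2 + ∑ i, p.2.1 i
  smooth := by fun_prop
  zero_eq t := by simp

theorem iteratedFDeriv_one_eq_of_hasDerivAt (f : SmoothFamily k) {v : ℝ × (Fin k → ℝ) × ℝ} {c : ℝ}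
    (h : HasDerivAt (fun s : ℝ => f.toFun (s • v)) c 0) :
    iteratedFDeriv ℝ 1 f.toFun 0 ![v] = c := by
  have h1 : HasDerivAt (fun s : ℝ => s • v) v 0 := by
    simpa using (hasDerivAt_id (0 : ℝ)).smul_const v
  have h2 := (f.smooth.differentiable (by simp) ((0 : ℝ) • v)).hasFDerivAt.comp_hasDerivAt 0 h1
  rw [iteratedFDeriv_one_apply]
  simpa using h2.unique h

theorem iteratedFDeriv_two_eq_of_hasDerivAt (f : SmoothFamily k) {v w : ℝ × (Fin k → ℝ) × ℝ}
    {d : ℝ → ℝ} {c : ℝ} (hd : ∀ r, HasDerivAt (fun s : ℝ => f.toFun (r • v + s • w)) (d r) 0)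
    (h : HasDerivAt d c 0) :
    iteratedFDeriv ℝ 2 f.toFun 0 ![v, w] = c := by
  have h1 : ∀ r : ℝ, fderiv ℝ f.toFun (r • v) w = d r := by
    intro r
    have h1 : HasDerivAt (fun s : ℝ => r • v + s • w) w 0 := by
      simpa using ((hasDerivAt_id (0 : ℝ)).smul_const w).const_add (r • v)
    have h2 := (f.smooth.differentiable (by simp)
      (r • v + (0 : ℝ) • w)).hasFDerivAt.comp_hasDerivAt 0 h1
    simpa using h2.unique (hd r)
  have h2 : HasDerivAt (fun s : ℝ => s • v) v 0 := by
    simpa using (hasDerivAt_id (0 : ℝ)).smul_const v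
  have h3 : ContDiff ℝ ∞ (fderiv ℝ f.toFun) := f.smooth.fderiv_right le_rfl
  have h4 : HasFDerivAt (fun p => fderiv ℝ f.toFun p w)
      ((fderiv ℝ (fderiv ℝ f.toFun) ((0 : ℝ) • v)).flip w) ((0 : ℝ) • v) := by
    simpa using (h3.differentiable (by simp) ((0 : ℝ) • v)).hasFDerivAt.clm_apply
      (hasFDerivAt_const w ((0 : ℝ) • v))
  rw [← show (fun r : ℝ => fderiv ℝ f.toFun (r • v) w) = d from funext h1] at h
  have h5 : HasDerivAt (fun r : ℝ => fderiv ℝ f.toFun (r • v) w)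
      ((fderiv ℝ (fderiv ℝ f.toFun) ((0 : ℝ) • v)).flip w v) 0 :=
    HasFDerivAt.comp_hasDerivAt (f := fun r : ℝ => r • v) 0 h4 h2
  replace h5 := h5.unique h
  rw [ContinuousLinearMap.flip_apply, zero_smul] at h5
  rw [iteratedFDeriv_two_apply]
  exact h5

theorem model_isNondegenerate : (model k).IsNondegenerate := by
  refine ⟨?_, ?_, fun hk => ?_⟩
  · rw [iteratedFDeriv_two_eq_of_hasDerivAt (model k) (d := fun r => 2 * r) (c := 2)]
    · norm_num
    · intro r
      simpa [model] using ((hasDerivAt_id (0 : ℝ)).const_add r).fun_pow 2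
    · simpa using (hasDerivAt_id (0 : ℝ)).const_mul 2
  · rw [iteratedFDeriv_two_eq_of_hasDerivAt (model k) (d := fun r => r) (c := 1)]
    · norm_num
    · intro r
      simpa [model] using ((hasDerivAt_id (0 : ℝ)).fun_pow 2).fun_add ((hasDerivAt_id (0 : ℝ)).mul_const r)
    · exact hasDerivAt_id 0
  · rw [iteratedFDeriv_one_eq_of_hasDerivAt (model k) (c := k)]
    · exact_mod_cast hk.ne'
    · simpa [model] using (hasDerivAt_id (0 : ℝ)).const_mul (k : ℝ)

theorem model_mem_internalDynamics : model k ∈ internalDynamics k := by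
  have : HasDerivAt (fun x : ℝ => (model k).toFun (x, 0, 0)) 0 0 := by
    simpa [model] using (hasDerivAt_id (0 : ℝ)).fun_pow 2
  exact this.deriv

theorem addSMul_mem_internalDynamics {f g : SmoothFamily k} (hf : f ∈ internalDynamics k)
    (hg : g ∈ internalDynamics k) (s : ℝ) : addSMul f g s ∈ internalDynamics k := by
  have hd : ∀ h : SmoothFamily k, DifferentiableAt ℝ (fun x : ℝ => h.toFun (x, 0, 0)) 0 := fun h =>
    ((h.smooth.differentiable (by simp)).comp
      (by fun_prop : Differentiable ℝ fun x : ℝ => (x, (0 : Fin k → ℝ), (0 : ℝ)))) 0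
  have := (hd f).hasDerivAt.add ((hd g).hasDerivAt.const_smul s)
  rw [show deriv (fun x : ℝ => f.toFun (x, 0, 0)) 0 = 0 from hf,
    show deriv (fun x : ℝ => g.toFun (x, 0, 0)) 0 = 0 from hg] at this
  have h0 : (0 : ℝ) + s • 0 = 0 := by simp
  exact this.deriv.trans h0

theorem eventually_ne_zero_add_mul (a : ℝ) {b : ℝ} (hb : b ≠ 0) :
    ∀ᶠ s : ℝ in 𝓝[≠] 0, a + s * b ≠ 0 := by
  rcases eq_or_ne a 0 with rfl | ha
  · filter_upwards [self_mem_nhdsWithin] with s hs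
    simpa [hb] using hs
  · have : ContinuousAt (fun s : ℝ => a + s * b) 0 := by fun_prop
    exact (this.eventually_ne (by simpa using ha)).filter_mono nhdsWithin_le_nhds

/-- Each condition is the nonvanishing of a linear functional. Along the line through `f` in
direction `g` it is affine in `s` with nonzero slope, hence has at most one zero. -/
theorem eventually_isNondegenerate_addSMul (f : SmoothFamily k) {g : SmoothFamily k}
    (hg : g.IsNondegenerate) : ∀ᶠ s : ℝ in 𝓝[≠] 0, (addSMul f g s).IsNondegenerate := by
  simp only [IsNondegenerate, iteratedFDeriv_addSMul, _root_.add_apply,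
    _root_.smul_apply, smul_eq_mul, eventually_and, eventually_imp_distrib_left]
  exact ⟨eventually_ne_zero_add_mul _ hg.1, eventually_ne_zero_add_mul _ hg.2.1,
    fun hk => eventually_ne_zero_add_mul _ (hg.2.2 hk)⟩

theorem dense_isNondegenerate : Dense {f : internalDynamics k | f.1.IsNondegenerate} := by
  intro f
  let φ : ℝ → internalDynamics k := fun s =>
    ⟨addSMul f.1 (model k) s, addSMul_mem_internalDynamics f.2 model_mem_internalDynamics s⟩
  have hφ : Continuous φ := (continuous_addSMul f.1 (model k)).subtype_mk _
  have h0 : φ 0 = f := Subtype.ext (addSMul_zero _ _)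
  refine mem_closure_of_tendsto (b := 𝓝[≠] (0 : ℝ)) (f := φ) ?_
    (eventually_isNondegenerate_addSMul f.1 model_isNondegenerate)
  have := hφ.tendsto 0
  rw [h0] at this
  exact this.mono_left nhdsWithin_le_nhds

/-! ### The normal form on synchronous inputs -/

theorem hasDerivAt_zero_mul_self {g : ℝ → ℝ} (hg : ContDiff ℝ ∞ g) :
    HasDerivAt (fun x => x * g x) (g 0) 0 := by
  simpa using (hasDerivAt_id (0 : ℝ)).fun_mul (hg.differentiable (by simp) 0).hasDerivAt

/-- If `∂f/∂x₀ (0) = 0`, then `f (x, (y, …, y), t) = x² P (x, t) + x t Q t + y R (y, x, t)`. -/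
theorem exists_normalForm {f : SmoothFamily k} (hf : f ∈ internalDynamics k)
    (hn : f.IsNondegenerate) :
    ∃ (P : ℝ × ℝ → ℝ) (Q : ℝ → ℝ) (R : ℝ × ℝ × ℝ → ℝ), ContDiff ℝ ∞ P ∧ ContDiff ℝ ∞ Q ∧
      ContDiff ℝ ∞ R ∧ P (0, 0) ≠ 0 ∧ Q 0 ≠ 0 ∧ (0 < k → R (0, 0, 0) ≠ 0) ∧
      ∀ x y t, f.toFun (x, fun _ => y, t) = x ^ 2 * P (x, t) + x * t * Q t + y * R (y, x, t) := by
  have hs := f.smooth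
  obtain ⟨K, hK, hK'⟩ := exists_contDiff_eq_mul (K := fun p : ℝ × ℝ => f.toFun (p.1, 0, p.2))
    (hs.comp (by fun_prop : ContDiff ℝ ∞ fun p : ℝ × ℝ => (p.1, (0 : Fin k → ℝ), p.2))) f.zero_eq
  obtain ⟨P, hP, hP'⟩ := exists_contDiff_eq_mul (K := fun p : ℝ × ℝ => K p - K (0, p.2))
    (hK.sub (hK.comp (by fun_prop : ContDiff ℝ ∞ fun p : ℝ × ℝ => ((0 : ℝ), p.2)))) (by simp)
  -- `K (0, 0)` is `∂f/∂x₀ (0)`: the bifurcation condition is what lets `K (0, t)` be divided by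
  -- `t`.
  have hK0 : K (0, 0) = 0 := by
    have h1 := hasDerivAt_zero_mul_self
      (hK.comp (by fun_prop : ContDiff ℝ ∞ fun x : ℝ => (x, (0 : ℝ))))
    simp only [Function.comp_def, ← hK'] at h1
    rw [← h1.deriv]
    exact hf
  -- The second coordinate is a dummy, later set to `0`.
  obtain ⟨Q, hQ, hQ'⟩ := exists_contDiff_eq_mul (K := fun p : ℝ × ℝ => K (0, p.1))
    (hK.comp (by fun_prop : ContDiff ℝ ∞ fun p : ℝ × ℝ => ((0 : ℝ), p.1))) fun _ => hK0
  obtain ⟨R, hR, hR'⟩ := exists_contDiff_eq_mul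
    (K := fun p : ℝ × ℝ × ℝ => f.toFun (p.2.1, fun _ => p.1, p.2.2) - f.toFun (p.2.1, 0, p.2.2))
    ((hs.comp (by fun_prop : ContDiff ℝ ∞ fun p : ℝ × ℝ × ℝ =>
      (p.2.1, (fun _ : Fin k => p.1), p.2.2))).sub (hs.comp (by fun_prop :
        ContDiff ℝ ∞ fun p : ℝ × ℝ × ℝ => (p.2.1, (0 : Fin k → ℝ), p.2.2))))
    (fun p => sub_self _)
  have hQs : ContDiff ℝ ∞ fun t : ℝ => Q (t, 0) := by fun_prop
  have hKP : ∀ x t, K (x, t) = x * P (x, t) + t * Q (t, 0) := fun x t => by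
    linear_combination hP' x t + hQ' t 0
  have hfx : ∀ x t, f.toFun (x, 0, t) = x * (x * P (x, t) + t * Q (t, 0)) := fun x t => by
    rw [← hKP]; exact hK' x t
  refine ⟨P, fun t => Q (t, 0), R, hP, hQs, hR, ?_, ?_, ?_, fun x y t => ?_⟩
  · intro h
    have hg : ContDiff ℝ ∞ fun x => P (x, 0) := by fun_prop
    have hg2 : ContDiff ℝ ∞ fun x => x * P (x, 0) := by fun_prop
    refine hn.1 (iteratedFDeriv_two_eq_of_hasDerivAt f
      (d := deriv fun x => x * (x * P (x, 0))) (fun r => ?_) ?_)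
    · have h1 : HasDerivAt (fun x => x * (x * P (x, 0))) (deriv (fun x => x * (x * P (x, 0))) (r + 0))
          (r + 0) := (by fun_prop : ContDiff ℝ ∞ fun x => x * (x * P (x, 0))).differentiable
            (by simp) _ |>.hasDerivAt
      have h2 := h1.comp_const_add r 0
      simpa [hfx] using h2
    · have h1 : (deriv fun x => x * (x * P (x, 0))) =
          fun x => x * (2 * P (x, 0) + x * deriv (fun x => P (x, 0)) x) := by
        funext x
        have h2 := (hg.differentiable (by simp) x).hasDerivAt
        have h3 := ((hasDerivAt_id x).mul ((hasDerivAt_id x).mul h2)).deriv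
        simp only [Pi.mul_def, id] at h3
        rw [h3]
        ring
      rw [h1]
      have hg' : ContDiff ℝ ∞ (deriv fun x => P (x, 0)) := by
        exact (contDiff_infty_iff_deriv.1 hg).2
      have := hasDerivAt_zero_mul_self
        (g := fun x => 2 * P (x, 0) + x * deriv (fun x => P (x, 0)) x) (by fun_prop)
      simpa [h] using this
  · intro h
    refine hn.2.1 (iteratedFDeriv_two_eq_of_hasDerivAt f (d := fun r => r * Q (r, 0))
      (fun r => ?_) ?_)
    · have := hasDerivAt_zero_mul_self (g := fun x => x * P (x, r) + r * Q (r, 0)) (by fun_prop)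
      simpa [hfx] using this
    · simpa [h] using hasDerivAt_zero_mul_self hQs
  · intro hk h
    refine hn.2.2 hk (iteratedFDeriv_one_eq_of_hasDerivAt f ?_)
    have := hasDerivAt_zero_mul_self (g := fun y => R (y, 0, 0)) (by fun_prop)
    simp only [← hR', h] at this
    have h0 : f.toFun (0, 0, 0) = 0 := f.zero_eq 0
    simp only [h0, sub_zero] at this
    convert this using 3 with s
    ext <;> simp
  · have := hR' y (x, t)
    simp only [] at this
    have h2 := hfx x t
    linear_combination this + h2

end SmoothFamily

/-! ### One-sided domains and square-root-orders -/

theorem IsOneSidedDomain.exists_sign {D : Set ℝ} (hD : IsOneSidedDomain D) :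
    ∃ δ t₀ : ℝ, (δ = 1 ∨ δ = -1) ∧ 0 < t₀ ∧ D = {t | 0 ≤ δ * t ∧ δ * t < t₀} := by
  obtain ⟨t₀, ht₀, rfl | rfl⟩ := hD
  · exact ⟨1, t₀, Or.inl rfl, ht₀, by ext; simp⟩
  · refine ⟨-1, t₀, Or.inr rfl, ht₀, ?_⟩
    ext t
    simp only [mem_Ioc, mem_ofPred_eq]
    constructor <;> rintro ⟨h1, h2⟩ <;> constructor <;> linarith

theorem isOneSidedDomain_sign {δ t₀ : ℝ} (hδ : δ = 1 ∨ δ = -1) (ht₀ : 0 < t₀) :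
    IsOneSidedDomain {t | 0 ≤ δ * t ∧ δ * t < t₀} := by
  refine ⟨t₀, ht₀, ?_⟩
  rcases hδ with rfl | rfl
  · left; ext; simp
  · right
    ext t
    simp only [mem_Ioc, mem_ofPred_eq]
    constructor <;> rintro ⟨h1, h2⟩ <;> constructor <;> linarith

theorem two_inv_pow_pos (q : ℕ) : 0 < (2 : ℝ)⁻¹ ^ q := by positivity

/-- This substitution allows the limit in `HasRootExpansion` to be evaluated at a root of `|t|`,
with the sign that keeps it in `D`. -/
theorem IsOneSidedDomain.exists_tendsto {D : Set ℝ} (hD : IsOneSidedDomain D) :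
    ∃ δ : ℝ, (δ = 1 ∨ δ = -1) ∧ ∀ a : ℝ, 0 < a →
      Tendsto (fun t : ℝ => δ * |t| ^ a) (𝓝[≠] 0) (𝓝[D \ {0}] 0) := by
  obtain ⟨δ, t₀, hδ, ht₀, rfl⟩ := hD.exists_sign
  refine ⟨δ, hδ, fun a ha => ?_⟩
  have hδδ : δ * δ = 1 := by rcases hδ with rfl | rfl <;> norm_num
  have h1 : Tendsto (fun t : ℝ => |t| ^ a) (𝓝 0) (𝓝 0) := by
    have : ContinuousAt (fun t : ℝ => |t| ^ a) 0 :=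
      (continuous_abs.rpow_const fun _ => Or.inr ha.le).continuousAt
    simpa [ContinuousAt, Real.zero_rpow ha.ne'] using this
  refine tendsto_nhdsWithin_iff.2 ⟨?_, ?_⟩
  · simpa using (h1.const_mul δ).mono_left nhdsWithin_le_nhds
  · filter_upwards [nhdsWithin_le_nhds (h1.eventually (gt_mem_nhds ht₀)), self_mem_nhdsWithin]
      with t ht ht0
    have hpos : 0 < |t| ^ a := Real.rpow_pos_of_pos (abs_pos.2 ht0) a
    refine ⟨?_, ?_⟩
    · simp only [mem_ofPred_eq, ← mul_assoc, hδδ, one_mul]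
      exact ⟨hpos.le, ht⟩
    · have : δ ≠ 0 := by rintro rfl; simp at hδδ
      exact mul_ne_zero this hpos.ne'

theorem IsOneSidedDomain.neBot {D : Set ℝ} (hD : IsOneSidedDomain D) :
    (𝓝[D \ {0}] (0 : ℝ)).NeBot := by
  obtain ⟨δ, -, h⟩ := hD.exists_tendsto
  exact (h 1 one_pos).neBot

/-- Substituting `δ |t| ^ 2⁻ᵠ` into the limit gives `g t / (δ |t| ^ 2⁻ᵠ) → s ≠ 0`. The growth rate
thus determines `q`, and minimality in the square-root-order is automatic. -/
theorem HasRootExpansion.isTheta {D : Set ℝ} (hD : IsOneSidedDomain D) {g : ℝ → ℝ} {q : ℕ} {s : ℝ}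
    (h : HasRootExpansion D g q s) :
    g =Θ[𝓝[D \ {0}] 0] fun t => |t| ^ ((2 : ℝ)⁻¹ ^ q) := by
  obtain ⟨hs, ε, hε, g', -, hg, hlim⟩ := h
  obtain ⟨δ, hδ, ht⟩ := hD.exists_tendsto
  have hq := two_inv_pow_pos q
  have hδa : |δ| = 1 := by rcases hδ with rfl | rfl <;> norm_num
  have hle : 𝓝[D \ {0}] (0 : ℝ) ≤ 𝓝[≠] 0 := nhdsWithin_mono _ fun t ht => ht.2
  have h1 := hlim.comp ((ht _ hq).mono_left hle)
  have h2 : (fun t => g' |t| / t) ∘ (fun t : ℝ => δ * |t| ^ ((2 : ℝ)⁻¹ ^ q)) =ᶠ[𝓝[D \ {0}] 0]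
      fun t => g t / (δ * |t| ^ ((2 : ℝ)⁻¹ ^ q)) := by
    have h3 : ∀ᶠ t : ℝ in 𝓝 0, |t| ^ ((2 : ℝ)⁻¹ ^ q) < ε := by
      have : ContinuousAt (fun t : ℝ => |t| ^ ((2 : ℝ)⁻¹ ^ q)) 0 :=
        (continuous_abs.rpow_const fun _ => Or.inr hq.le).continuousAt
      exact this.eventually (gt_mem_nhds (by simpa [Real.zero_rpow hq.ne'] using hε))
    filter_upwards [nhdsWithin_le_nhds h3, self_mem_nhdsWithin] with t ht1 ht2
    have hpos : 0 ≤ |t| ^ ((2 : ℝ)⁻¹ ^ q) := by positivity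
    simp only [Function.comp_apply, abs_mul, hδa, one_mul, abs_of_nonneg hpos]
    rw [hg t ht2.1 ht1]
  have h4 : (fun t : ℝ => δ * |t| ^ ((2 : ℝ)⁻¹ ^ q)) =Θ[𝓝[D \ {0}] 0]
      fun t => |t| ^ ((2 : ℝ)⁻¹ ^ q) := by
    refine (Asymptotics.isTheta_const_mul_left ?_).2 (Asymptotics.isTheta_refl _ _)
    rintro rfl
    simp at hδa
  exact (Asymptotics.isTheta_of_div_tendsto_nhds_ne_zero (h1.congr' h2) hs).symm.trans h4

theorem le_of_isBigO_abs_rpow {l : Filter ℝ} [l.NeBot] (hl : l ≤ 𝓝[≠] 0) {a b : ℝ}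
    (h : (fun t : ℝ => |t| ^ a) =O[l] fun t => |t| ^ b) : b ≤ a := by
  by_contra! hab
  obtain ⟨C, hC⟩ := h.bound
  have hpos : 0 < b - a := by linarith
  have h0 : Tendsto (fun t : ℝ => C * |t| ^ (b - a)) l (𝓝 0) := by
    have : ContinuousAt (fun t : ℝ => |t| ^ (b - a)) 0 :=
      (continuous_abs.rpow_const fun _ => Or.inr hpos.le).continuousAt
    have h1 : Tendsto (fun t : ℝ => |t| ^ (b - a)) l (𝓝 0) := by
      simpa [ContinuousAt, Real.zero_rpow hpos.ne'] using
        this.tendsto.mono_left (hl.trans nhdsWithin_le_nhds)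
    simpa using h1.const_mul C
  obtain ⟨t, ht, ht1, ht0⟩ :=
    (hC.and ((h0.eventually (gt_mem_nhds one_pos)).and (hl self_mem_nhdsWithin))).exists
  have htp : 0 < |t| := abs_pos.2 ht0
  have ha : 0 < |t| ^ a := Real.rpow_pos_of_pos htp a
  have hb : 0 < |t| ^ b := Real.rpow_pos_of_pos htp b
  rw [Real.norm_of_nonneg ha.le, Real.norm_of_nonneg hb.le] at ht
  rw [Real.rpow_sub htp, ← mul_div_assoc, div_lt_one ha] at ht1
  linarith

theorem HasRootExpansion.le_of_isBigO {D : Set ℝ} (hD : IsOneSidedDomain D) {g : ℝ → ℝ} {q r : ℕ}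
    {s : ℝ} (h : HasRootExpansion D g q s)
    (hg : g =O[𝓝[D \ {0}] 0] fun t => |t| ^ ((2 : ℝ)⁻¹ ^ r)) : q ≤ r := by
  have := hD.neBot
  have h1 := le_of_isBigO_abs_rpow (nhdsWithin_mono _ fun t ht => ht.2)
    ((h.isTheta hD).symm.isBigO.trans hg)
  exact (pow_le_pow_iff_right_of_lt_one₀ (by norm_num) (by norm_num)).1 h1

theorem HasRootExpansion.not_eventually_eq_zero {D : Set ℝ} (hD : IsOneSidedDomain D) {g : ℝ → ℝ}
    {q : ℕ} {s : ℝ} (h : HasRootExpansion D g q s) : ¬ ∀ᶠ t in 𝓝[D] 0, g t = 0 := by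
  intro h0
  have := hD.neBot
  have hle : 𝓝[D \ {0}] (0 : ℝ) ≤ 𝓝[D] 0 := nhdsWithin_mono _ sdiff_subset
  -- Any exponent larger than that of `g` would do, since the zero germ is dominated by all of them.
  have h1 : g =O[𝓝[D \ {0}] 0] fun t => |t| ^ ((2 : ℝ)⁻¹ ^ q + 1) :=
    (Asymptotics.isBigO_zero _ _).congr' ((h0.filter_mono hle).mono fun t ht => ht.symm) EventuallyEq.rfl
  have h2 := le_of_isBigO_abs_rpow (nhdsWithin_mono _ fun t ht => ht.2)
    ((h.isTheta hD).symm.isBigO.trans h1)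
  linarith

theorem HasRootExpansion.hasSquareRootOrder {D : Set ℝ} (hD : IsOneSidedDomain D) {g : ℝ → ℝ}
    {q : ℕ} {s : ℝ} (h : HasRootExpansion D g q s) : HasSquareRootOrder D g q :=
  Or.inr ⟨h.not_eventually_eq_zero hD, q, rfl, ⟨s, h⟩,
    fun _ ⟨_, h'⟩ => h.le_of_isBigO hD (h'.isTheta hD).isBigO⟩

theorem HasSquareRootOrder.le_of_isBigO {D : Set ℝ} (hD : IsOneSidedDomain D) {g : ℝ → ℝ} {p : ℤ}
    {r : ℕ} (h : HasSquareRootOrder D g p)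
    (hg : g =O[𝓝[D] 0] fun t => |t| ^ ((2 : ℝ)⁻¹ ^ r)) : p ≤ r := by
  rcases h with ⟨-, rfl⟩ | ⟨-, q, rfl, ⟨s, hs⟩, -⟩
  · linarith [Int.natCast_nonneg r]
  · exact_mod_cast hs.le_of_isBigO hD (hg.mono (nhdsWithin_mono _ sdiff_subset))

theorem HasSquareRootOrder.eq_neg_one {D : Set ℝ} {g : ℝ → ℝ} {p : ℤ}
    (h : HasSquareRootOrder D g p) (hg : ∀ᶠ t in 𝓝[D] 0, g t = 0) : p = -1 := by
  rcases h with ⟨-, h⟩ | ⟨h, -⟩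
  · exact h
  · exact absurd hg h

/-! ### Bounds for equilibrium branches -/

namespace SmoothFamily

variable {k : ℕ} {f : SmoothFamily k}

theorem eventually_eq_zero_of_selfInput (hk : 0 < k) (hf : f ∈ internalDynamics k)
    (hn : f.IsNondegenerate) :
    ∀ᶠ p : ℝ × ℝ in 𝓝 (0, 0), f.toFun (p.1, fun _ => p.1, p.2) = 0 → p.1 = 0 := by
  obtain ⟨P, Q, R, hP, hQ, hR, -, -, hR0, hfm⟩ := exists_normalForm hf hn
  have hc : Continuous fun p : ℝ × ℝ => p.1 * P p + p.2 * Q p.2 + R (p.1, p.1, p.2) := by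
    have := hP.continuous
    have := hQ.continuous
    have := hR.continuous
    fun_prop
  filter_upwards [hc.continuousAt.eventually_ne
    (by simpa using hR0 hk : (0 : ℝ) * P (0, 0) + 0 * Q 0 + R (0, 0, 0) ≠ 0)] with p hp h
  rw [hfm] at h
  have : p.1 * (p.1 * P p + p.2 * Q p.2 + R (p.1, p.1, p.2)) = 0 := by linear_combination h
  exact (mul_eq_zero.1 this).resolve_right hp

/-- The inputs `y` need not be synchronous. Only `f (x, 0, t)` is put in normal form; since `f (x,
y, t) = 0`, it is at most a Lipschitz constant times `‖y‖`. Then `P` is bounded away from `0`. -/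
theorem exists_sq_le (hf : f ∈ internalDynamics k) (hn : f.IsNondegenerate) :
    ∃ C : ℝ, 0 < C ∧ ∀ᶠ p : ℝ × (Fin k → ℝ) × ℝ in 𝓝 0, f.toFun p = 0 →
      p.1 ^ 2 ≤ C * (|p.2.2| * |p.1| + ‖p.2.1‖) := by
  obtain ⟨P, Q, R, hP, hQ, -, hP0, -, -, hfm⟩ := exists_normalForm hf hn
  obtain ⟨M, U, hU, hM⟩ := (f.smooth.contDiffAt (x := 0)).of_le
    (by exact_mod_cast le_top : (1 : WithTop ℕ∞) ≤ ∞) |>.exists_lipschitzOnWith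
  have hp : 0 < |P (0, 0)| / 2 := by positivity
  have c1 : ∀ᶠ p : ℝ × (Fin k → ℝ) × ℝ in 𝓝 0, |P (0, 0)| / 2 < |P (p.1, p.2.2)| := by
    have := hP.continuous
    have h : Continuous fun p : ℝ × (Fin k → ℝ) × ℝ => |P (p.1, p.2.2)| := by fun_prop
    exact h.continuousAt.eventually (lt_mem_nhds (by
      simp only [Prod.fst_zero, Prod.snd_zero]; linarith))
  have c2 : ∀ᶠ p : ℝ × (Fin k → ℝ) × ℝ in 𝓝 0, |Q p.2.2| < |Q 0| + 1 := by
    have := hQ.continuous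
    have h : Continuous fun p : ℝ × (Fin k → ℝ) × ℝ => |Q p.2.2| := by fun_prop
    exact h.continuousAt.eventually (gt_mem_nhds (by simp))
  have c3 : ∀ᶠ p : ℝ × (Fin k → ℝ) × ℝ in 𝓝 0, (p.1, (0 : Fin k → ℝ), p.2.2) ∈ U := by
    have h : Continuous fun p : ℝ × (Fin k → ℝ) × ℝ => (p.1, (0 : Fin k → ℝ), p.2.2) := by fun_prop
    exact h.continuousAt.eventually hU
  set m := |P (0, 0)| / 2
  refine ⟨(|Q 0| + 1 + M) / m, by positivity, ?_⟩
  filter_upwards [c1, c2, c3, hU] with p h1 h2 h3 h4 h0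
  have h5 := hM.dist_le_mul p h4 _ h3
  rw [Real.dist_eq, h0, zero_sub, abs_neg] at h5
  have h6 : dist p (p.1, (0 : Fin k → ℝ), p.2.2) = ‖p.2.1‖ := by
    simp [Prod.dist_eq]
  rw [h6] at h5
  have h7 := hfm p.1 0 p.2.2
  have h8 : p.1 ^ 2 * |P (p.1, p.2.2)| ≤ |p.1| * |p.2.2| * |Q p.2.2| + M * ‖p.2.1‖ := by
    have h9 : p.1 ^ 2 * P (p.1, p.2.2) = f.toFun (p.1, 0, p.2.2) - p.1 * p.2.2 * Q p.2.2 := by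
      have h10 : (fun _ : Fin k => (0 : ℝ)) = 0 := rfl
      rw [h10] at h7
      rw [h7]
      ring
    calc p.1 ^ 2 * |P (p.1, p.2.2)| = |p.1 ^ 2 * P (p.1, p.2.2)| := by
          rw [abs_mul, abs_of_nonneg (sq_nonneg p.1)]
      _ ≤ |f.toFun (p.1, 0, p.2.2)| + |p.1 * p.2.2 * Q p.2.2| := by
          rw [h9]; exact abs_sub _ _
      _ ≤ |p.1| * |p.2.2| * |Q p.2.2| + M * ‖p.2.1‖ := by
          rw [abs_mul, abs_mul]; linarith
  rw [div_mul_eq_mul_div, le_div_iff₀ (by positivity)]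
  have hA : 0 ≤ |p.2.2| * |p.1| := by positivity
  have hM0 : (0 : ℝ) ≤ M := M.2
  have hB := norm_nonneg p.2.1
  have hQ0 := abs_nonneg (Q 0)
  calc p.1 ^ 2 * m ≤ p.1 ^ 2 * |P (p.1, p.2.2)| := by gcongr
    _ ≤ |p.1| * |p.2.2| * |Q p.2.2| + M * ‖p.2.1‖ := h8
    _ ≤ |p.1| * |p.2.2| * (|Q 0| + 1) + M * ‖p.2.1‖ := by gcongr
    _ ≤ (|Q 0| + 1 + M) * (|p.2.2| * |p.1| + ‖p.2.1‖) := by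
      nlinarith [mul_nonneg hM0 hA, mul_nonneg hQ0 hB]

theorem isBigO_rpow_of_zero (hf : f ∈ internalDynamics k) (hn : f.IsNondegenerate) {D : Set ℝ}
    {x : ℝ → ℝ} {y : ℝ → Fin k → ℝ} (hx : Tendsto x (𝓝[D] 0) (𝓝 0))
    (hy : Tendsto y (𝓝[D] 0) (𝓝 0)) (h0 : ∀ᶠ t in 𝓝[D] 0, f.toFun (x t, y t, t) = 0) {a : ℝ}
    (ha : 0 < a) (ha1 : a ≤ 1) (hyO : y =O[𝓝[D] 0] fun t => |t| ^ (2 * a)) :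
    x =O[𝓝[D] 0] fun t => |t| ^ a := by
  obtain ⟨C, hC, hb⟩ := exists_sq_le hf hn
  obtain ⟨C', hC', hb'⟩ := hyO.exists_nonneg
  have ht : Tendsto (fun t : ℝ => t) (𝓝[D] 0) (𝓝 0) := tendsto_id.mono_left nhdsWithin_le_nhds
  have hlim : Tendsto (fun t => (x t, y t, t)) (𝓝[D] 0) (𝓝 0) := hx.prodMk_nhds (hy.prodMk_nhds ht)
  have hone : ∀ᶠ t : ℝ in 𝓝[D] 0, |t| < 1 := by
    have := ht.abs
    rw [abs_zero] at this
    exact this.eventually (gt_mem_nhds one_pos)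
  refine Asymptotics.IsBigO.of_bound (C + C * C' + 1) ?_
  filter_upwards [hlim.eventually hb, h0, hb'.bound, hone] with t h1 h2 h3 h4
  specialize h1 h2
  have hw : 0 ≤ |t| ^ a := by positivity
  have hw2 : |t| ^ (2 * a) = |t| ^ a * |t| ^ a := by
    rw [mul_comm, Real.rpow_mul (abs_nonneg t), ← pow_two]
    norm_num
  have htw : |t| ≤ |t| ^ a := by
    rcases eq_or_ne t 0 with rfl | ht0
    · simp [Real.zero_rpow ha.ne']
    · simpa using Real.rpow_le_rpow_of_exponent_ge (abs_pos.2 ht0) h4.le ha1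
  rw [hw2, Real.norm_of_nonneg (mul_nonneg hw hw)] at h3
  rw [Real.norm_of_nonneg hw, Real.norm_eq_abs]
  set w := |t| ^ a
  -- If `|x|` exceeds the bound, then `w ≤ |x|`, so both `|t| |x|` and `‖y‖ ≤ C' w²` are at most
  -- constants times `w |x|`. This gives `x² ≤ (C + C C') w |x| < x²`.
  by_contra! hlt
  have hwx : w ≤ |x t| := by
    have : 0 ≤ (C + C * C') * w := by positivity
    linarith
  have h5 : |x t| ^ 2 ≤ C * (w * |x t| + C' * (w * |x t|)) := by
    rw [sq_abs]
    refine h1.trans ?_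
    gcongr
    exact h3.trans (by gcongr)
  have hxpos : 0 < |x t| := lt_of_le_of_lt (by positivity) hlt
  have h6 : |x t| * ((C + C * C' + 1) * w) < |x t| * |x t| := by gcongr
  nlinarith [mul_nonneg hw hxpos.le]

end SmoothFamily

section Bounds

variable {k : ℕ} {C : Type*} [Fintype C] {f : SmoothFamily k} {N : CellNetwork k C} {D : Set ℝ}
  {b : ℝ → C → ℝ}

theorem IsBranchDomain.zero_mem (hD : IsBranchDomain D) : (0 : ℝ) ∈ D := by
  rcases hD with ⟨t₀, h, rfl | rfl⟩ | ⟨t₀, h, rfl⟩ <;> simpa using h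

theorem IsEquilibriumBranch.tendsto (hb : IsEquilibriumBranch f N D b) (c : C) :
    Tendsto (fun t => b t c) (𝓝[D] 0) (𝓝 0) := by
  have h1 : Tendsto b (𝓝[D] 0) (𝓝 (b 0)) := hb.continuousOn 0 hb.domain.zero_mem
  rw [hb.zero_eq] at h1
  exact tendsto_pi_nhds.1 h1 c

theorem IsEquilibriumBranch.eventually_eq_zero (hk : 0 < k)
    (hf : f ∈ SmoothFamily.internalDynamics k) (hn : f.IsNondegenerate)
    (hb : IsEquilibriumBranch f N D b) {c : C} (hc : ∀ i, N.input i c = c) :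
    ∀ᶠ t in 𝓝[D] 0, b t c = 0 := by
  have ht : Tendsto (fun t : ℝ => t) (𝓝[D] 0) (𝓝 0) := tendsto_id.mono_left nhdsWithin_le_nhds
  filter_upwards [((hb.tendsto c).prodMk_nhds ht).eventually
    (SmoothFamily.eventually_eq_zero_of_selfInput hk hf hn), self_mem_nhdsWithin] with t h1 h2
  refine h1 ?_
  have := congrFun (hb.isEquilibrium t h2) c
  simpa [SmoothFamily.vectorField, hc] using this

theorem IsEquilibriumBranch.isBigO {m : ℕ} {layer : C → ℕ} (hk : 0 < k)
    (hf : f ∈ SmoothFamily.internalDynamics k) (hn : f.IsNondegenerate)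
    (hN : N.IsFeedForward m layer) (hb : IsEquilibriumBranch f N D b) (j : ℕ) :
    ∀ c, layer c = j + 1 → (fun t => b t c) =O[𝓝[D] 0] fun t => |t| ^ ((2 : ℝ)⁻¹ ^ j) := by
  induction j with
  | zero =>
    intro c hc
    refine SmoothFamily.isBigO_rpow_of_zero hf hn (y := fun t i => b t (N.input i c))
      (hb.tendsto c) (tendsto_pi_nhds.2 fun i => hb.tendsto _) ?_ (two_inv_pow_pos _) (by simp) ?_
    · filter_upwards [self_mem_nhdsWithin] with t ht
      exact congrFun (hb.isEquilibrium t ht) c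
    · refine Asymptotics.isBigO_pi.2 fun i => ?_
      have h1 : layer (N.input i c) = 0 := by
        have := hN.input_next c (by omega) i
        omega
      refine (Asymptotics.isBigO_zero _ _).congr' ?_ EventuallyEq.rfl
      filter_upwards [hb.eventually_eq_zero hk hf hn (hN.input_first _ h1)] with t ht
      exact ht.symm
  | succ j ih =>
    intro c hc
    refine SmoothFamily.isBigO_rpow_of_zero hf hn (y := fun t i => b t (N.input i c))
      (hb.tendsto c) (tendsto_pi_nhds.2 fun i => hb.tendsto _) ?_ (two_inv_pow_pos _)
      (pow_le_one₀ (by norm_num) (by norm_num)) ?_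
    · filter_upwards [self_mem_nhdsWithin] with t ht
      exact congrFun (hb.isEquilibrium t ht) c
    · refine Asymptotics.isBigO_pi.2 fun i => ?_
      have h1 : layer (N.input i c) = j + 1 := by
        have := hN.input_next c (by omega) i
        omega
      have h2 : (2 : ℝ) * 2⁻¹ ^ (j + 1) = 2⁻¹ ^ j := by
        rw [pow_succ]; ring
      rw [h2]
      exact ih _ h1

theorem IsEquilibriumBranch.squareRootOrder_lt {m : ℕ} {layer : C → ℕ} (hk : 0 < k)
    (hf : f ∈ SmoothFamily.internalDynamics k) (hn : f.IsNondegenerate)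
    (hN : N.IsFeedForward m layer) (hb : IsEquilibriumBranch f N D b) (hD : IsOneSidedDomain D)
    {p : ℤ} (hp : HasSquareRootOrderIn D b univ p) : p < m := by
  obtain ⟨q, hq, ⟨c, -, rfl⟩, -⟩ := hp
  have h1 := hq c (mem_univ c)
  have hcm := hN.layer_le c
  rcases hj : layer c with _ | j
  · rw [h1.eq_neg_one (hb.eventually_eq_zero hk hf hn (hN.input_first c hj))]
    omega
  · have := h1.le_of_isBigO hD (hb.isBigO hk hf hn hN j c hj)
    omega

end Bounds

/-! ### The layerwise synchronous branch -/

/-- The root of the leading-order equation is real by the sign condition. Of its two signs, the one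
chosen reproduces the condition, so that the next layer can be solved too. -/
theorem exists_leading_coefficient {P R a : ℝ} (hP : P ≠ 0) (ha : 0 < -(P * R) * a) :
    ∃ u : ℝ, u ^ 2 * P + a * R = 0 ∧ 0 < -(P * R) * u := by
  have hR : R ≠ 0 := by rintro rfl; simp at ha
  set w := √(-(P * R) * a) / P with hw
  have hw2 : w ^ 2 * P + a * R = 0 := by
    rw [hw, div_pow, Real.sq_sqrt ha.le]
    field_simp
    ring
  have hw0 : -(P * R) * w ≠ 0 :=
    mul_ne_zero (neg_ne_zero.2 (mul_ne_zero hP hR)) (div_ne_zero (Real.sqrt_ne_zero'.2 ha) hP)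
  rcases lt_or_gt_of_ne hw0 with h | h
  · exact ⟨-w, by rw [neg_sq]; exact hw2, by linarith⟩
  · exact ⟨w, hw2, h⟩

namespace SmoothFamily

variable {k : ℕ} {f : SmoothFamily k}

theorem exists_profile_first {P : ℝ × ℝ → ℝ} {Q : ℝ → ℝ} {R : ℝ × ℝ × ℝ → ℝ} (hP : ContDiff ℝ ∞ P)
    (hQ : ContDiff ℝ ∞ Q) (hP0 : P (0, 0) ≠ 0) (hQ0 : Q 0 ≠ 0) (hR0 : R (0, 0, 0) ≠ 0)
    (hfm : ∀ x y t, f.toFun (x, fun _ => y, t) = x ^ 2 * P (x, t) + x * t * Q t + y * R (y, x, t)) :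
    ∃ (δ : ℝ) (h : ℝ → ℝ), (δ = 1 ∨ δ = -1) ∧ ContDiff ℝ ∞ h ∧
      0 < -(P (0, 0) * R (0, 0, 0)) * h 0 ∧
      ∀ᶠ τ in 𝓝 0, f.toFun (τ * h τ, fun _ => 0, δ * τ) = 0 := by
  -- After division by `τ² h` the equation reads `h P + δ Q = 0`, so `h 0 = -δ Q / P` and the sign
  -- condition becomes `0 < δ R Q`. This selects the side of `t = 0`.
  obtain ⟨δ, hδ, hpos⟩ : ∃ δ : ℝ, (δ = 1 ∨ δ = -1) ∧ 0 < δ * (R (0, 0, 0) * Q 0) := by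
    rcases lt_or_gt_of_ne (mul_ne_zero hR0 hQ0) with h | h
    · exact ⟨-1, Or.inr rfl, by linarith⟩
    · exact ⟨1, Or.inl rfl, by linarith⟩
  obtain ⟨h, hh, hh0, hz⟩ := exists_contDiff_implicit
    (F := fun p : ℝ × ℝ => p.2 * P (p.1 * p.2, δ * p.1) + δ * Q (δ * p.1))
    (u₀ := -(δ * Q 0) / P (0, 0)) (c := P (0, 0)) (by fun_prop) (by simp; field_simp; ring)
    (by simpa using ((hasDerivAt_id _).mul_const (P (0, 0))).add_const (δ * Q 0)) hP0
  refine ⟨δ, h, hδ, hh, ?_, ?_⟩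
  · rw [hh0]
    convert hpos using 1
    field_simp
  · filter_upwards [hz] with τ hτ
    rw [hfm]
    linear_combination τ ^ 2 * h τ * hτ

theorem exists_profile_next {P : ℝ × ℝ → ℝ} {Q : ℝ → ℝ} {R : ℝ × ℝ × ℝ → ℝ} (hP : ContDiff ℝ ∞ P)
    (hQ : ContDiff ℝ ∞ Q) (hR : ContDiff ℝ ∞ R) (hP0 : P (0, 0) ≠ 0)
    (hfm : ∀ x y t, f.toFun (x, fun _ => y, t) = x ^ 2 * P (x, t) + x * t * Q t + y * R (y, x, t))
    (δ : ℝ) {e : ℕ} (he : 2 ≤ e) {g : ℝ → ℝ} (hg : ContDiff ℝ ∞ g)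
    (hg0 : 0 < -(P (0, 0) * R (0, 0, 0)) * g 0) :
    ∃ h : ℝ → ℝ, ContDiff ℝ ∞ h ∧ 0 < -(P (0, 0) * R (0, 0, 0)) * h 0 ∧
      ∀ᶠ τ in 𝓝 0, f.toFun (τ * h τ, fun _ => τ ^ 2 * g (τ ^ 2), δ * τ ^ e) = 0 := by
  obtain ⟨e, rfl⟩ := Nat.exists_eq_add_of_le' he
  obtain ⟨u, hu, hu0⟩ := exists_leading_coefficient hP0 hg0
  have hune : u ≠ 0 := by rintro rfl; simp at hu0
  have hd := (((hasDerivAt_id u).fun_pow 2).mul_const (P (0, 0))).add_const (g 0 * R (0, 0, 0))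
  -- `F` is the equation divided by `τ²`. As the exponent of `t` is at least `2`, its middle term
  -- vanishes at `τ = 0`, leaving `u² P + g(0) R = 0`, a simple root because `u ≠ 0`.
  obtain ⟨h, hh, hh0, hz⟩ := exists_contDiff_implicit
    (F := fun p : ℝ × ℝ => p.2 ^ 2 * P (p.1 * p.2, δ * p.1 ^ (e + 2)) +
      p.2 * (δ * p.1 ^ (e + 1)) * Q (δ * p.1 ^ (e + 2)) +
      g (p.1 ^ 2) * R (p.1 ^ 2 * g (p.1 ^ 2), p.1 * p.2, δ * p.1 ^ (e + 2)))
    (u₀ := u) (c := 2 * u * P (0, 0)) (by fun_prop) (by simpa using hu)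
    (by simpa using hd) (mul_ne_zero (mul_ne_zero two_ne_zero hune) hP0)
  refine ⟨h, hh, by rwa [hh0], ?_⟩
  filter_upwards [hz] with τ hτ
  rw [hfm]
  linear_combination τ ^ 2 * hτ

/-- Here `τ = |t| ^ 2⁻ʲ` in layer `j + 1`, so the square of one layer's variable is the variable of
the layer before. The recursion carries smoothness and the sign condition in a subtype. -/
theorem exists_profiles (hk : 0 < k) (hf : f ∈ internalDynamics k) (hn : f.IsNondegenerate) :
    ∃ (δ : ℝ) (h : ℕ → ℝ → ℝ), (δ = 1 ∨ δ = -1) ∧ (∀ j, ContDiff ℝ ∞ (h j)) ∧ (∀ j, h j 0 ≠ 0) ∧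
      (∀ᶠ τ in 𝓝 0, f.toFun (τ * h 0 τ, fun _ => 0, δ * τ) = 0) ∧
      ∀ j, ∀ᶠ τ in 𝓝 0,
        f.toFun (τ * h (j + 1) τ, fun _ => τ ^ 2 * h j (τ ^ 2), δ * τ ^ 2 ^ (j + 1)) = 0 := by
  obtain ⟨P, Q, R, hP, hQ, hR, hP0, hQ0, hR0, hfm⟩ := exists_normalForm hf hn
  obtain ⟨δ, h₀, hδ, hh₀, hpos, hz⟩ := exists_profile_first hP hQ hP0 hQ0 (hR0 hk) hfm
  have step : ∀ (j : ℕ)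
      (g : {g : ℝ → ℝ // ContDiff ℝ ∞ g ∧ 0 < -(P (0, 0) * R (0, 0, 0)) * g 0}),
      ∃ h : {g : ℝ → ℝ // ContDiff ℝ ∞ g ∧ 0 < -(P (0, 0) * R (0, 0, 0)) * g 0}, ∀ᶠ τ in 𝓝 0,
        f.toFun (τ * h.1 τ, fun _ => τ ^ 2 * g.1 (τ ^ 2), δ * τ ^ 2 ^ (j + 1)) = 0 := fun j g => by
    obtain ⟨h, h1, h2, h3⟩ := exists_profile_next hP hQ hR hP0 hfm δ
      (Nat.le_self_pow j.succ_ne_zero 2) g.2.1 g.2.2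
    exact ⟨⟨h, h1, h2⟩, h3⟩
  choose next hnext using step
  let h : ℕ → {g : ℝ → ℝ // ContDiff ℝ ∞ g ∧ 0 < -(P (0, 0) * R (0, 0, 0)) * g 0} :=
    fun j => Nat.rec ⟨h₀, hh₀, hpos⟩ next j
  refine ⟨δ, fun j => (h j).1, hδ, fun j => (h j).2.1, fun j h0 => ?_, hz, fun j => hnext j (h j)⟩
  exact (h j).2.2.ne' (mul_eq_zero_of_right _ h0)

/-- The coordinates `X j` of an equilibrium branch on a feed-forward network that is synchronous on
each layer: `X j` is the state of the layer `j`. -/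
theorem exists_layerwise_branch (hk : 0 < k) (hf : f ∈ internalDynamics k)
    (hn : f.IsNondegenerate) :
    ∃ (δ : ℝ) (X : ℕ → ℝ → ℝ), (δ = 1 ∨ δ = -1) ∧ X 0 = 0 ∧ (∀ j, Continuous (X j)) ∧
      (∀ j, X j 0 = 0) ∧ (∀ j, ∀ t ≠ 0, ContDiffAt ℝ ∞ (X j) t) ∧
      (∀ j, ∀ᶠ t in 𝓝 0, 0 ≤ δ * t → f.toFun (X (j + 1) t, fun _ => X j t, t) = 0) ∧
      ∀ j, ∀ D ⊆ {t | 0 ≤ δ * t}, ∃ s, HasRootExpansion D (X (j + 1)) j s := by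
  obtain ⟨δ, h, hδ, hh, hh0, hz0, hz⟩ := exists_profiles hk hf hn
  have hδδ : δ * δ = 1 := by rcases hδ with rfl | rfl <;> norm_num
  have hδa : |δ| = 1 := by rcases hδ with rfl | rfl <;> norm_num
  have habs : ∀ t : ℝ, 0 ≤ δ * t → δ * |t| = t := fun t ht => by
    rw [← one_mul |t|, ← hδa, ← abs_mul, abs_of_nonneg ht, ← mul_assoc, hδδ, one_mul]
  let ρ : ℕ → ℝ → ℝ := fun j t => |t| ^ ((2 : ℝ)⁻¹ ^ j)
  have hρ : ∀ j, Continuous (ρ j) := fun j =>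
    continuous_abs.rpow_const fun _ => Or.inr (two_inv_pow_pos j).le
  have hρ0 : ∀ j, ρ j 0 = 0 := fun j => by simp [ρ]
  have hρlim : ∀ j, Tendsto (ρ j) (𝓝 0) (𝓝 0) := fun j => by
    simpa [hρ0] using (hρ j).tendsto 0
  have hρs : ∀ j t, ρ (j + 1) t ^ 2 = ρ j t := fun j t => by
    simp only [ρ]
    rw [← Real.rpow_mul_natCast (abs_nonneg t)]
    congr 1
    rw [pow_succ]
    push_cast
    ring
  have hρp : ∀ j t, ρ j t ^ 2 ^ j = |t| := fun j t => by
    induction j with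
    | zero => simp [ρ]
    | succ j ih => rw [pow_succ', pow_mul, hρs, ih]
  -- Layer `0` rests at `0`; layer `i + 1` is the profile `τ h i τ` at `τ = ρ i t = |t| ^ 2⁻ⁱ`.
  refine ⟨δ, fun j => Nat.casesOn j 0 fun i t => ρ i t * h i (ρ i t), hδ, rfl, ?_, ?_, ?_, ?_, ?_⟩
  · rintro (_ | j)
    · exact continuous_const
    · exact (hρ j).mul ((hh j).continuous.comp (hρ j))
  · rintro (_ | j)
    · rfl
    · simp [hρ0]
  · rintro (_ | j) t ht
    · exact contDiffAt_const
    · have h1 : ContDiffAt ℝ ∞ (ρ j) t := (contDiffAt_abs ht).rpow_const_of_ne (abs_ne_zero.2 ht)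
      exact h1.mul ((hh j).contDiffAt.comp t h1)
  · rintro (_ | j)
    · filter_upwards [(hρlim 0).eventually hz0] with t ht hpos
      have : ρ 0 t = |t| := by simp [ρ]
      rw [this, habs t hpos] at ht
      simpa [this] using ht
    · filter_upwards [(hρlim (j + 1)).eventually (hz j)] with t ht hpos
      rw [hρp, hρs, habs t hpos] at ht
      exact ht
  · intro j D hD
    -- On this side `t = δ |t|`, so `|t| h j |t| / t = δ h j |t|`.
    refine ⟨δ * h j 0, mul_ne_zero (by rintro rfl; simp at hδa) (hh0 j), 1, one_pos,
      fun τ => τ * h j τ, (contDiff_id.mul (hh j)).contDiffOn, fun t _ _ => rfl, ?_⟩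
    have h1 : Tendsto (fun t : ℝ => δ * h j |t|) (𝓝[D \ {0}] 0) (𝓝 (δ * h j 0)) := by
      have : Continuous fun t : ℝ => δ * h j |t| :=
        continuous_const.mul ((hh j).continuous.comp continuous_abs)
      simpa using (this.tendsto 0).mono_left nhdsWithin_le_nhds
    refine h1.congr' ?_
    filter_upwards [self_mem_nhdsWithin] with t ht
    have h2 := habs t (hD ht.1)
    have h3 : t ≠ 0 := ht.2
    rw [eq_div_iff h3]
    calc δ * h j |t| * t = δ * h j |t| * (δ * |t|) := by rw [h2]
      _ = |t| * h j |t| := by linear_combination |t| * h j |t| * hδδ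

end SmoothFamily

theorem exists_layerwise_bifurcationBranch {k : ℕ} {f : SmoothFamily k} {C : Type*} [Fintype C]
    {L : CellNetwork k C} {n : ℕ} {layer : C → ℕ} (hk : 0 < k)
    (hf : f ∈ SmoothFamily.internalDynamics k) (hn : f.IsNondegenerate)
    (hL : L.IsFeedForward n layer) (hn0 : 0 < n) :
    ∃ (D : Set ℝ) (b : ℝ → C → ℝ), IsOneSidedDomain D ∧ IsBifurcationBranch f L D b ∧
      (∀ c, layer c = 0 → ∀ t, b t c = 0) ∧
      (∀ c, layer c = 1 → ¬ ∀ᶠ t in 𝓝[D] 0, b t c = 0) ∧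
      HasSquareRootOrderIn D b univ (n - 1) := by
  obtain ⟨δ, X, hδ, hX0, hXc, hXz, hXs, hXe, hXr⟩ :=
    SmoothFamily.exists_layerwise_branch hk hf hn
  have hall : ∀ᶠ t : ℝ in 𝓝 0, ∀ j ∈ Finset.range n, 0 ≤ δ * t →
      f.toFun (X (j + 1) t, fun _ => X j t, t) = 0 :=
    (eventually_all_finset _).2 fun j _ => hXe j
  obtain ⟨t₀, ht₀, hball⟩ := Metric.eventually_nhds_iff.1 hall
  set D : Set ℝ := {t | 0 ≤ δ * t ∧ δ * t < t₀} with hDdef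
  have hD : IsOneSidedDomain D := isOneSidedDomain_sign hδ ht₀
  have hDt : ∀ t ∈ D, dist t 0 < t₀ := fun t ht => by
    rw [Real.dist_eq, sub_zero]
    have hδa : |δ| = 1 := by rcases hδ with rfl | rfl <;> norm_num
    rw [← one_mul |t|, ← hδa, ← abs_mul, abs_of_nonneg ht.1]
    exact ht.2
  have hr : ∀ j, ∃ s, HasRootExpansion D (X (j + 1)) j s := fun j => hXr j D fun t ht => ht.1
  have h1 : ∀ c, layer c = 1 → ¬ ∀ᶠ t in 𝓝[D] 0, X (layer c) t = 0 := fun c hc => by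
    obtain ⟨s, hs⟩ := hr 0
    rw [hc]
    exact hs.not_eventually_eq_zero hD
  refine ⟨D, fun t c => X (layer c) t, hD, ⟨⟨Or.inl hD, ?_, ?_, ?_, ?_⟩, ?_⟩, ?_, h1, ?_⟩
  · exact (continuous_pi fun c => hXc _).continuousOn
  · exact contDiffOn_pi.2 fun c t ht => (hXs _ t ht.2).contDiffWithinAt
  · exact funext fun c => hXz _
  · intro t ht
    funext c
    simp only [SmoothFamily.vectorField, Pi.zero_apply]
    rcases hj : layer c with _ | j
    · have h2 : ∀ i, layer (L.input i c) = 0 := fun i => by rw [hL.input_first c hj i, hj]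
      simp only [h2, hX0]
      exact f.zero_eq t
    · have h2 : ∀ i, layer (L.input i c) = j := fun i => by
        have := hL.input_next c (by omega) i
        omega
      have h3 := hL.layer_le c
      simp only [h2]
      exact hball (hDt t ht) j (Finset.mem_range.2 (by omega)) ht.1
  · obtain ⟨c, hc⟩ := hL.layer_nonempty 1 hn0
    exact fun h => h1 c hc (h.mono fun t ht => congrFun ht c)
  · intro c hc t
    simp [hc, hX0]
  -- The shift by one gives `-1` on layer `0`, the order of the zero germ.
  · refine ⟨fun c => (layer c : ℤ) - 1, fun c _ => ?_, ?_, ?_⟩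
    · rcases hj : layer c with _ | j
      · exact Or.inl ⟨Eventually.of_forall fun t => by simp [hj, hX0], by simp [hj]⟩
      · obtain ⟨s, hs⟩ := hr j
        simpa [hj] using hs.hasSquareRootOrder hD
    · obtain ⟨c, hc⟩ := hL.layer_nonempty n le_rfl
      exact ⟨c, mem_univ c, by simp [hc]⟩
    · rintro _ ⟨c, -, rfl⟩
      have := hL.layer_le c
      simp only
      omega

/-! ### Lifts of feed-forward networks -/

namespace CellNetwork

variable {k : ℕ} {C C' : Type*} {N : CellNetwork k C} {L : CellNetwork k C'}

/-- The projection of a lift. -/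
theorem IsQuotientBy.exists_projection {r : Setoid C'} (h : L.IsQuotientBy r N) :
    ∃ φ : C' → C, Function.Surjective φ ∧ (∀ i c, φ (L.input i c) = N.input i (φ c)) ∧
      ∀ c d, r c d ↔ φ c = φ d := by
  obtain ⟨hb, φ, hφ⟩ := h
  refine ⟨fun c => φ (Quotient.mk r c), φ.surjective.comp Quotient.mk_surjective,
    fun i c => ?_, fun c d => ?_⟩
  · exact hφ i (Quotient.mk r c)
  · exact ⟨fun h => congrArg φ (Quotient.sound h), fun h => Quotient.exact (φ.injective h)⟩

theorem IsFeedForward.pos_of_pos {m : ℕ} {layer : C → ℕ} (hN : N.IsFeedForward m layer)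
    (hm : 0 < m) : 0 < k := by
  obtain ⟨c, hc⟩ := hN.layer_nonempty 0 (Nat.zero_le m)
  obtain ⟨-, i, -⟩ := hN.isSource c (by omega)
  exact i.pos

/-- With a single layer all edges are loops, so connectedness leaves one cell. -/
theorem IsFeedForward.subsingleton {layer : C → ℕ} (hN : N.IsFeedForward 0 layer) :
    Subsingleton C := by
  refine ⟨fun c d => ?_⟩
  have h0 : ∀ c, layer c = 0 := fun c => Nat.le_zero.1 (hN.layer_le c)
  induction hN.connected c d with
  | refl => rfl
  | tail _ h ih =>
    rcases h with ⟨i, h⟩ | ⟨i, h⟩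
    · rw [ih, h, hN.input_first _ (h0 _)]
    · rw [ih, h, hN.input_first _ (h0 _)]

theorem IsFeedForward.ncard_layer_eq_one {layer : C → ℕ} (hN : N.IsFeedForward 0 layer) :
    {c | layer c = 0}.ncard = 1 := by
  obtain ⟨c, hc⟩ := hN.layer_nonempty 0 le_rfl
  have := hN.subsingleton
  refine ncard_eq_one.2 ⟨c, ?_⟩
  ext d
  simp [Subsingleton.elim d c, hc]

theorem IsFeedForward.layer_input {m : ℕ} {layer : C → ℕ} (hN : N.IsFeedForward m layer) (i : Fin k)
    (c : C) : layer (N.input i c) = layer c - 1 := by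
  rcases Nat.eq_zero_or_pos (layer c) with h | h
  · rw [hN.input_first c h, h]
  · have := hN.input_next c h.ne' i
    omega

variable {m n : ℕ} {layer : C → ℕ} {layer' : C' → ℕ} {φ : C' → C}

/-- The cells over the last layer lie in the last layer. -/
theorem IsFeedForward.layer_eq_of_projection (hN : N.IsFeedForward m layer)
    (hL : L.IsFeedForward n layer') (hφ : ∀ i c, φ (L.input i c) = N.input i (φ c)) (hm : 0 < m)
    {c : C'} (hc : layer (φ c) = m) : layer' c = n := by
  by_contra h
  -- A cell below the last layer is the source of some `c'`. Its image would lie one layer below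
  -- that of `c'`, which would then be in layer `m + 1`; for `m = 0` the truncated subtraction would
  -- break this.
  obtain ⟨c', i, -, rfl⟩ := hL.isSource c (lt_of_le_of_ne (hL.layer_le c) h)
  rw [hφ, hN.layer_input] at hc
  have := hN.layer_le (φ c')
  omega

theorem IsFeedForward.layer_iterate_input (hN : N.IsFeedForward m layer) (i : Fin k) (j : ℕ)
    (c : C) : layer ((N.input i)^[j] c) = layer c - j := by
  induction j with
  | zero => rfl
  | succ j ih => rw [Function.iterate_succ_apply', hN.layer_input, ih]; omega

/-- A projection from a network with more layers identifies some cell of the layer `1` with its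
sources. -/
theorem IsFeedForward.exists_collapsed_cell (hN : N.IsFeedForward m layer)
    (hL : L.IsFeedForward n layer') (hs : Function.Surjective φ)
    (hφ : ∀ i c, φ (L.input i c) = N.input i (φ c)) (hmn : m < n) (i : Fin k) :
    ∃ c, layer' c = 1 ∧ φ (L.input i c) = φ c := by
  obtain ⟨c, hc, hcm⟩ : ∃ c, layer' c = n ∧ layer (φ c) ≤ m := by
    rcases Nat.eq_zero_or_pos m with rfl | hm
    · obtain ⟨c, hc⟩ := hL.layer_nonempty n le_rfl
      exact ⟨c, hc, hN.layer_le _⟩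
    · obtain ⟨c₀, hc₀⟩ := hN.layer_nonempty m le_rfl
      obtain ⟨c, rfl⟩ := hs c₀
      exact ⟨c, hN.layer_eq_of_projection hL hφ hm hc₀, hc₀.le⟩
  have hit : Function.Semiconj φ (L.input i) (N.input i) := hφ i
  -- From the last layer, `n - 1 ≥ m` steps reach layer `1` of `L` but already layer `0` of `N`,
  -- where inputs are loops.
  refine ⟨(L.input i)^[n - 1] c, ?_, ?_⟩
  · rw [hL.layer_iterate_input]; omega
  · rw [hφ]
    refine hN.input_first _ ?_ i
    rw [(hit.iterate_right (n - 1)).eq, hN.layer_iterate_input]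
    omega

/-- The projection of a lift with equally many layers and no new cells in the last one preserves the
layers. -/
theorem IsFeedForward.projection_preserves_layers [Finite C] [Finite C']
    (hN : N.IsFeedForward m layer) (hL : L.IsFeedForward m layer') (hs : Function.Surjective φ)
    (hφ : ∀ i c, φ (L.input i c) = N.input i (φ c)) (hm : 0 < m)
    (hcard : {c | layer' c = m}.ncard ≤ {c | layer c = m}.ncard) (c : C') :
    layer (φ c) = layer' c := by
  -- The preimage of the last layer lies in the last layer and, by surjectivity, has at least as
  -- many cells as its image; the count forces equality. Lower layers follow by passing to sources.
  have htop : ∀ c, layer' c = m → layer (φ c) = m := by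
    have h1 : φ ⁻¹' {c | layer c = m} ⊆ {c | layer' c = m} := fun c hc =>
      hN.layer_eq_of_projection hL hφ hm hc
    have h2 : {c | layer c = m}.ncard ≤ (φ ⁻¹' {c | layer c = m}).ncard := by
      conv_lhs => rw [← image_preimage_eq {c | layer c = m} hs]
      exact ncard_image_le (toFinite _)
    intro c hc
    have h3 := eq_of_subset_of_ncard_le h1 (hcard.trans h2)
    have : c ∈ φ ⁻¹' {c | layer c = m} := by rw [h3]; exact hc
    exact this
  obtain ⟨j, hj⟩ := Nat.exists_eq_add_of_le (hL.layer_le c)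
  induction j generalizing c with
  | zero => rw [htop c (by omega)]; omega
  | succ j ih =>
    obtain ⟨c', i, h1, rfl⟩ := hL.isSource c (by omega)
    rw [hφ, hN.layer_input, ih c' (by omega), h1]
    omega

theorem IsFeedForward.eq_of_projection_eq [Finite C] [Finite C']
    (hl : ∀ c, layer (φ c) = layer' c) (hs : Function.Surjective φ) {j : ℕ}
    (hcard : {c | layer' c = j}.ncard = {c | layer c = j}.ncard) {c d : C'} (hc : layer' c = j)
    (h : φ c = φ d) : c = d := by
  have himg : φ '' {c | layer' c = j} = {c | layer c = j} := by
    ext x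
    constructor
    · rintro ⟨c, hc, rfl⟩
      exact (hl c).trans hc
    · intro hx
      obtain ⟨c, rfl⟩ := hs x
      exact ⟨c, (hl c).symm.trans hx, rfl⟩
  have hinj := injOn_of_ncard_image_eq (f := φ) (s := {c | layer' c = j}) (by rw [himg, hcard])
    (toFinite _)
  exact hinj hc (show layer' d = j by rw [← hl, ← h, hl, hc]) h

end CellNetwork

/-! ### Lifting and non-lifting of branches, and the proposition -/

theorem IsBifurcationBranch.isLiftedFrom_of_isInsideLayer {k : ℕ} {f : SmoothFamily k}
    {C C' : Type*} [Fintype C] [Fintype C'] {N : CellNetwork k C} {L : CellNetwork k C'} {m n : ℕ}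
    {layer : C → ℕ} {layer' : C' → ℕ} (hf : f ∈ SmoothFamily.internalDynamics k)
    (hn : f.IsNondegenerate) (hN : N.IsFeedForward m layer) (hL : L.IsFeedForward n layer')
    (hlift : L.IsLift N) (hin : IsInsideLayer m layer n layer' 0) {D : Set ℝ} {b : ℝ → C' → ℝ}
    (hb : IsBifurcationBranch f L D b) : IsLiftedFrom L N D b := by
  obtain ⟨-, rfl, hne, hcard⟩ := hin
  rcases Nat.eq_zero_or_pos m with rfl | hm
  -- With a single layer both networks have one cell, so the first layers cannot differ in size.
  · exact absurd (hL.ncard_layer_eq_one.trans hN.ncard_layer_eq_one.symm) hne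
  obtain ⟨r, hr⟩ := hlift
  obtain ⟨φ, hs, hφ, hrφ⟩ := hr.exists_projection
  have hl := hN.projection_preserves_layers hL hs hφ hm (hcard m le_rfl hm.ne').le
  have hzero : ∀ᶠ t in 𝓝[D] 0, ∀ c, layer' c = 0 → b t c = 0 := by
    refine eventually_all.2 fun c => ?_
    by_cases hc : layer' c = 0
    · simpa [hc] using hb.1.eventually_eq_zero (hN.pos_of_pos hm) hf hn (hL.input_first c hc)
    · simp [hc]
  refine ⟨r, hr, hzero.mono fun t ht c d hcd => ?_⟩
  have hcd' := (hrφ c d).1 hcd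
  by_cases hc : layer' c = 0
  · rw [ht c hc, ht d (by rw [← hl, ← hcd', hl, hc])]
  · rw [CellNetwork.IsFeedForward.eq_of_projection_eq hl hs (hcard _ (hL.layer_le c) hc) rfl hcd']

/-- Every coloring with quotient `N` identifies some cell of layer `1` with its source in layer `0`;
synchrony would force the former to vanish. -/
theorem not_isLiftedFrom_of_layer_lt {k : ℕ} {C C' : Type*} {N : CellNetwork k C}
    {L : CellNetwork k C'} {m n : ℕ} {layer : C → ℕ} {layer' : C' → ℕ} (hk : 0 < k)
    (hN : N.IsFeedForward m layer) (hL : L.IsFeedForward n layer') (hmn : m < n) {D : Set ℝ}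
    {b : ℝ → C' → ℝ} (h0 : ∀ c, layer' c = 0 → ∀ t, b t c = 0)
    (h1 : ∀ c, layer' c = 1 → ¬ ∀ᶠ t in 𝓝[D] 0, b t c = 0) : ¬ IsLiftedFrom L N D b := by
  rintro ⟨r, hr, hb⟩
  obtain ⟨φ, hs, hφ, hrφ⟩ := hr.exists_projection
  obtain ⟨c, hc, hcol⟩ := hN.exists_collapsed_cell hL hs hφ hmn ⟨0, hk⟩
  refine h1 c hc (hb.mono fun t ht => ?_)
  rw [← ht _ _ ((hrφ _ _).2 hcol)]
  exact h0 _ (by rw [hL.layer_input, hc]) t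

theorem mainTheorem8 (k : ℕ) :
    ∃ G : Set (SmoothFamily.internalDynamics k), IsOpen G ∧ Dense G ∧
      ∀ f ∈ G, ∀ (C C' : Type*) [Fintype C] [Fintype C']
        (N : CellNetwork k C) (m : ℕ) (layer : C → ℕ)
        (L : CellNetwork k C') (n : ℕ) (layer' : C' → ℕ),
        N.IsFeedForward m layer → L.IsFeedForward n layer' → L.IsLift N →
        (IsInsideLayer m layer n layer' 0 →
          ∀ (D : Set ℝ) (b : ℝ → C' → ℝ),
            IsBifurcationBranch f.1 L D b → IsLiftedFrom L N D b) ∧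
        (CreatesNewLayers m layer n layer' →
          ∃ (D : Set ℝ) (b : ℝ → C' → ℝ) (q : ℤ),
            IsBifurcationBranch f.1 L D b ∧ ¬ IsLiftedFrom L N D b ∧
            IsOneSidedDomain D ∧ HasSquareRootOrderIn D b univ q ∧
            ∀ (D₁ : Set ℝ) (b₁ : ℝ → C → ℝ) (p : ℤ),
              IsOneSidedDomain D₁ → IsBifurcationBranch f.1 N D₁ b₁ →
              HasSquareRootOrderIn D₁ b₁ univ p → p < q) := by
  refine ⟨{f | f.1.IsNondegenerate},
    SmoothFamily.isOpen_isNondegenerate.preimage continuous_subtype_val,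
    SmoothFamily.dense_isNondegenerate, ?_⟩
  intro f hn C C' _ _ N m layer L n layer' hN hL hlift
  refine ⟨fun hin D b hb => hb.isLiftedFrom_of_isInsideLayer f.2 hn hN hL hlift hin, ?_⟩
  rintro ⟨hmn, -, -⟩
  have hk : 0 < k := hL.pos_of_pos (by omega)
  obtain ⟨D, b, hD, hb, h0, h1, hq⟩ :=
    exists_layerwise_bifurcationBranch hk f.2 hn hL (by omega)
  refine ⟨D, b, n - 1, hb, not_isLiftedFrom_of_layer_lt hk hN hL hmn h0 h1, hD, hq, ?_⟩
  intro D₁ b₁ p hD₁ hb₁ hp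
  have := hb₁.1.squareRootOrder_lt hk f.2 hn hN hD₁ hp
  omega
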